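/- **Theorem 1.** For a group $H$ let $H^1=H$, $H^{n+1}=[H,H^n]$. Call a group $\Gamma$ a *Malcev group* if every abelian group $\Gamma^n/\Gamma^{n+1}$ ($n\ge 1$) is a $\mathbb{Q}$-vector space and the natural map $\Gamma\to\varprojlim_n\Gamma/\Gamma^n$ is an isomorphism. A *Malcev $\mathbb{Q}$-completion* of a group $G$ is a homomorphism $G\to\widehat G$ to a Malcev group that induces isomorphisms $(G^n/G^{n+1})\otimes\mathbb{Q}\to\widehat G^n/\widehat G^{n+1}$ for all $n\ge 1$. For a Lie algebra $M$ over $\mathbb{Q}$ let $M^1=M$, $M^{n+1}=[M,M^n]$, let $\widehat M=\varprojlim_n M/M^n$ be its *pronilpotent completion*, and call $M$ *pronilpotent* if the natural map $M\to\widehat M$ is an isomorphism. The Baker–Campbell–Hausdorff series $x*y=\log(e^xe^y)=x+y+\tfrac12[x,y]+\cdots$ has only finitely many non-zero terms in each nilpotent Lie algebra $M/M^n$, and so defines a product $*$ on $\widehat M$. The pronilpotent Lie algebra *associated* with a Malcev group $\Gamma$ by the Malcev correspondence is the pronilpotent Lie algebra $M$ such that $\Gamma$ is isomorphic to $(M,*)$,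 through an isomorphism that identifies $\Gamma/\Gamma^n$ with $(M/M^n,*)$ for every $n$. Let $G=\langle a,b\mid [a,b^{-i}ab^i]=1,\ i\in\mathbb{Z}\rangle$ be the lamplighter group $\mathbb{Z}\wr\mathbb{Z}$, and let $L=\mathbb{Q}[x]\rtimes\mathbb{Q}t$ be the rational lamplighter Lie algebra, the semidirect product of the abelian Lie algebras $\mathbb{Q}[x]$ and $\mathbb{Q}t$ with $[p,t]=xp$ for $p\in\mathbb{Q}[x]$. Then $G$ has a Malcev $\mathbb{Q}$-completion, and for every Malcev $\mathbb{Q}$-completion $G\to\widehat G$ the pronilpotent completion $\widehat L$ of $L$ is the Lie algebra associated with $\widehat G$ by the Malcev correspondence. In other terms, $\widehat G$ is isomorphic to the group $(\widehat L,*)$, where $*$ is the Baker–Campbell–Hausdorff product. -/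

import Mathlib

open Polynomial
open scoped Nat

namespace Lamplighter

/-! ### Groups: lower central quotients, completion, Malcev completion

`gLCS G n` is the `n`-th term of the lower central series, counted from `0`: with the convention
`G^1 = G`, `G^{k+1} = [G, G^k]` it is `G^{n+1}`. -/

section Groups

open scoped commutatorElement

/-- The lower central series of a group, with `gLCS G 0 = G`. -/
abbrev gLCS (G : Type*) [Group G] (n : ℕ) : Subgroup G :=
  (⊤ : Subgroup G).lowerCentralSeries n

theorem gLCS_antitone (G : Type*) [Group G] : Antitone (gLCS G) :=
  Subgroup.lowerCentralSeries_antitone _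

theorem map_gLCS_le {G H : Type*} [Group G] [Group H] (f : G →* H) (n : ℕ) :
    (gLCS G n).map f ≤ gLCS H n := by
  induction n with
  | zero => exact le_top
  | succ n ih =>
    simp only [gLCS, Subgroup.lowerCentralSeries_succ, Subgroup.map_commutator]
    exact Subgroup.commutator_mono ih le_top

/-- The lower central quotient `gLCS G n / gLCS G (n + 1)`. -/
abbrev Gr (G : Type*) [Group G] (n : ℕ) : Type _ :=
  ↥(gLCS G n) ⧸ (gLCS G (n + 1)).subgroupOf (gLCS G n)

theorem gr_mul_comm (G : Type*) [Group G] (n : ℕ) (a b : Gr G n) : a * b = b * a := by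
  induction a using QuotientGroup.induction_on with
  | H a =>
    induction b using QuotientGroup.induction_on with
    | H b =>
      rw [← QuotientGroup.mk_mul, ← QuotientGroup.mk_mul, QuotientGroup.eq,
        Subgroup.mem_subgroupOf]
      have h : ⁅((b : G))⁻¹, ((a : G))⁻¹⁆ ∈ gLCS G (n + 1) :=
        Subgroup.commutator_mem_commutator (inv_mem b.2) (Subgroup.mem_top _)
      have e : (((a * b)⁻¹ * (b * a) : ↥(gLCS G n)) : G) = ⁅((b : G))⁻¹, ((a : G))⁻¹⁆ := by
        simp [commutatorElement_def, mul_assoc]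
      rw [e]
      exact h

instance (G : Type*) [Group G] (n : ℕ) : CommGroup (Gr G n) :=
  { (inferInstance : Group (Gr G n)) with mul_comm := gr_mul_comm G n }

/-- The map that a homomorphism induces on lower central quotients. -/
def grMap {G H : Type*} [Group G] [Group H] (f : G →* H) (n : ℕ) : Gr G n →* Gr H n :=
  QuotientGroup.map _ _
    ((f.comp (gLCS G n).subtype).codRestrict (gLCS H n)
      fun g => map_gLCS_le f n (Subgroup.mem_map_of_mem f g.2))
    fun _ hg => Subgroup.mem_subgroupOf.2
      (map_gLCS_le f (n + 1) (Subgroup.mem_map_of_mem f (Subgroup.mem_subgroupOf.1 hg)))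

/-- `grMap` in additive notation, as a `ℤ`-linear map. -/
def grLinearMap {G H : Type*} [Group G] [Group H] (f : G →* H) (n : ℕ) :
    Additive (Gr G n) →ₗ[ℤ] Additive (Gr H n) :=
  (MonoidHom.toAdditive (grMap f n)).toIntLinearMap

/-- The transition map `G / gLCS G n → G / gLCS G m` for `m ≤ n`. -/
def gTransition (G : Type*) [Group G] {m n : ℕ} (h : m ≤ n) :
    G ⧸ gLCS G n →* G ⧸ gLCS G m :=
  QuotientGroup.map _ _ (MonoidHom.id G) (gLCS_antitone G h)

/-- The inverse limit of the groups `G / gLCS G n`. -/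
def gLimit (G : Type*) [Group G] : Subgroup (∀ n : ℕ, G ⧸ gLCS G n) where
  carrier := {f | ∀ m n : ℕ, ∀ h : m ≤ n, gTransition G h (f n) = f m}
  one_mem' := fun m n h => map_one (gTransition G h)
  mul_mem' := fun {a b} ha hb m n h => by
    rw [Pi.mul_apply, Pi.mul_apply, map_mul, ha m n h, hb m n h]
  inv_mem' := fun {a} ha m n h => by
    rw [Pi.inv_apply, Pi.inv_apply, map_inv, ha m n h]

/-- The natural map from `G` to the inverse limit of its nilpotent quotients. -/
def toGLimit (G : Type*) [Group G] : G →* gLimit G where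
  toFun g := ⟨fun _ => QuotientGroup.mk g, fun _ _ _ => rfl⟩
  map_one' := rfl
  map_mul' _ _ := rfl

/-- A Malcev group: every lower central quotient is a `ℚ`-vector space and the natural map to the
inverse limit of the nilpotent quotients is an isomorphism. (An abelian group carries at most one
structure of `ℚ`-vector space.) -/
def IsMalcevGroup (Γ : Type*) [Group Γ] : Prop :=
  (∀ n : ℕ, Nonempty (Module ℚ (Additive (Gr Γ n)))) ∧ Function.Bijective (toGLimit Γ)

/-- A Malcev `ℚ`-completion of `G`: a homomorphism to a Malcev group inducing isomorphisms
`(gLCS G n / gLCS G (n + 1)) ⊗ ℚ → gLCS Γ n / gLCS Γ (n + 1)` for all `n`. -/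
def IsMalcevCompletion {G Γ : Type*} [Group G] [Group Γ] (η : G →* Γ) : Prop :=
  IsMalcevGroup Γ ∧
    ∀ n : ℕ, ∃ _ : Module ℚ (Additive (Gr Γ n)), IsBaseChange ℚ (grLinearMap η n)

/-- The relators `[a, b⁻ⁱ a bⁱ]`, `i ∈ ℤ`, in the free group on `a = of 0` and `b = of 1`. -/
def relators : Set (FreeGroup (Fin 2)) :=
  Set.range fun i : ℤ =>
    ⁅(FreeGroup.of 0 : FreeGroup (Fin 2)),
      (FreeGroup.of 1) ^ (-i) * FreeGroup.of 0 * (FreeGroup.of 1) ^ i⁆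

/-- The lamplighter group `⟨a, b | [a, b⁻ⁱ a bⁱ] = 1, i ∈ ℤ⟩`. -/
abbrev LamplighterGroup : Type := PresentedGroup relators

end Groups

/-! ### Lie algebras over `ℚ`: pronilpotent completion -/

section LieAlgebras

/-- The lower central series of a Lie algebra, with `lLCS L 0 = L`. -/
abbrev lLCS (L : Type*) [LieRing L] [LieAlgebra ℚ L] (n : ℕ) : LieIdeal ℚ L :=
  LieModule.lowerCentralSeries ℚ L L n

variable (L : Type*) [LieRing L] [LieAlgebra ℚ L]

/-- The transition map `L / lLCS L n → L / lLCS L m` for `m ≤ n`. -/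
def lTransition {m n : ℕ} (h : m ≤ n) : (L ⧸ lLCS L n) →ₗ⁅ℚ⁆ (L ⧸ lLCS L m) where
  toLinearMap := Submodule.mapQ (lLCS L n).toSubmodule (lLCS L m).toSubmodule LinearMap.id
    (LieModule.antitone_lowerCentralSeries ℚ L L h)
  map_lie' := fun {a b} => by
    induction a using Submodule.Quotient.induction_on with
    | H a =>
      induction b using Submodule.Quotient.induction_on with
      | H b => rfl

theorem lTransition_mk {m n : ℕ} (h : m ≤ n) (a : L) :
    lTransition L h (LieSubmodule.Quotient.mk a) = LieSubmodule.Quotient.mk a := rfl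

/-- The inverse limit of the Lie algebras `L / lLCS L n`, as a subspace of the product. -/
def lLimit : Submodule ℚ (∀ n : ℕ, L ⧸ lLCS L n) where
  carrier := {f | ∀ m n : ℕ, ∀ h : m ≤ n, lTransition L h (f n) = f m}
  zero_mem' := fun m n h => map_zero (lTransition L h)
  add_mem' := fun {a b} ha hb m n h => by
    rw [Pi.add_apply, Pi.add_apply, map_add, ha m n h, hb m n h]
  smul_mem' := fun c a ha m n h => by
    rw [Pi.smul_apply, Pi.smul_apply, map_smul, ha m n h]

/-- The pronilpotent completion of `L`. -/
abbrev PronilpotentCompletion : Type _ := ↥(lLimit L)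

/-- The bracket of the pronilpotent completion is taken componentwise. -/
instance : LieRing (PronilpotentCompletion L) where
  bracket x y := ⟨fun n => ⁅x.1 n, y.1 n⁆, fun m n h => by
    rw [LieHom.map_lie, x.2 m n h, y.2 m n h]⟩
  add_lie x y z := Subtype.ext (funext fun n => add_lie (x.1 n) (y.1 n) (z.1 n))
  lie_add x y z := Subtype.ext (funext fun n => lie_add (x.1 n) (y.1 n) (z.1 n))
  lie_self x := Subtype.ext (funext fun n => lie_self (x.1 n))
  leibniz_lie x y z := Subtype.ext (funext fun n => leibniz_lie (x.1 n) (y.1 n) (z.1 n))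

instance : LieAlgebra ℚ (PronilpotentCompletion L) where
  lie_smul c x y := Subtype.ext (funext fun n => lie_smul c (x.1 n) (y.1 n))

/-- The natural map from `L` to its pronilpotent completion. -/
def toCompletion : L →ₗ⁅ℚ⁆ PronilpotentCompletion L where
  toFun a := ⟨fun _ => LieSubmodule.Quotient.mk a, fun _ _ _ => rfl⟩
  map_add' _ _ := rfl
  map_smul' _ _ := rfl
  map_lie' := rfl

/-- `L` is pronilpotent if the natural map to its pronilpotent completion is an isomorphism. -/
def IsPronilpotent : Prop := Function.Bijective (toCompletion L)

end LieAlgebras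

/-! ### The Baker–Campbell–Hausdorff product -/

section BCH

/-- The right-normed bracket `[a₁, [a₂, [… , [aₖ₋₁, aₖ] …]]]` of a list. -/
def rightNormed {L : Type*} [LieRing L] : List L → L
  | [] => 0
  | [a] => a
  | a :: b :: l => ⁅a, rightNormed (b :: l)⁆

/-- The word `x^{r₁} y^{s₁} ⋯ x^{rₖ} y^{sₖ}`, where `rs i = (rᵢ, sᵢ)`. -/
def dynkinWord {L : Type*} (x y : L) {k : ℕ} (rs : Fin k → ℕ × ℕ) : List L :=
  (List.ofFn rs).flatMap fun p => List.replicate p.1 x ++ List.replicate p.2 y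

/-- The families `(rᵢ, sᵢ)`, `i = 1, …, k`, with `rᵢ + sᵢ > 0` and `∑ (rᵢ + sᵢ) = d`. -/
def dynkinIndex (d k : ℕ) : Finset (Fin k → ℕ × ℕ) :=
  (Fintype.piFinset fun _ => Finset.range (d + 1) ×ˢ Finset.range (d + 1)).filter fun rs =>
    (∀ i, 0 < (rs i).1 + (rs i).2) ∧ ∑ i, ((rs i).1 + (rs i).2) = d

/-- The homogeneous part of degree `d` of the Baker–Campbell–Hausdorff series
`log (exp x exp y)`, in Dynkin's form. -/
noncomputable def bchTerm {L : Type*} [LieRing L] [LieAlgebra ℚ L] (d : ℕ) (x y : L) : L :=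
  ∑ k ∈ Finset.Icc 1 d, ∑ rs ∈ dynkinIndex d k,
    ((-1 : ℚ) ^ (k - 1) / (k * d * ∏ i, (((rs i).1 ! : ℚ) * ((rs i).2 ! : ℚ)))) •
      rightNormed (dynkinWord x y rs)

/-- The Baker–Campbell–Hausdorff series up to degree `n`. -/
noncomputable def bchPartial {L : Type*} [LieRing L] [LieAlgebra ℚ L] (n : ℕ) (x y : L) : L :=
  ∑ d ∈ Finset.Icc 1 n, bchTerm d x y

theorem rightNormed_map {L M : Type*} [LieRing L] [LieAlgebra ℚ L] [LieRing M] [LieAlgebra ℚ M]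
    (f : L →ₗ⁅ℚ⁆ M) : ∀ l : List L, f (rightNormed l) = rightNormed (l.map f)
  | [] => map_zero f
  | [_] => rfl
  | a :: b :: l => by
    simp only [rightNormed, List.map_cons, LieHom.map_lie]
    rw [rightNormed_map f (b :: l), List.map_cons]

theorem bchTerm_map {L M : Type*} [LieRing L] [LieAlgebra ℚ L] [LieRing M] [LieAlgebra ℚ M]
    (f : L →ₗ⁅ℚ⁆ M) (d : ℕ) (x y : L) : f (bchTerm d x y) = bchTerm d (f x) (f y) := by
  simp only [bchTerm, map_sum, map_smul, rightNormed_map]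
  simp only [dynkinWord, List.map_flatMap, List.map_append, List.map_replicate]

theorem bchPartial_map {L M : Type*} [LieRing L] [LieAlgebra ℚ L] [LieRing M] [LieAlgebra ℚ M]
    (f : L →ₗ⁅ℚ⁆ M) (n : ℕ) (x y : L) : f (bchPartial n x y) = bchPartial n (f x) (f y) := by
  simp only [bchPartial, map_sum, bchTerm_map]

theorem rightNormed_mem {L : Type*} [LieRing L] [LieAlgebra ℚ L] :
    ∀ (n : ℕ) (l : List L), n + 1 ≤ l.length → rightNormed l ∈ lLCS L n
  | 0, _, _ => LieSubmodule.mem_top _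
  | n + 1, a :: b :: l, h => by
    have h' : n + 1 ≤ (b :: l).length := Nat.le_of_succ_le_succ h
    rw [rightNormed, lLCS, LieModule.lowerCentralSeries_succ]
    exact LieSubmodule.lie_mem_lie (LieSubmodule.mem_top a) (rightNormed_mem n (b :: l) h')
  | n + 1, [], h => by simp at h
  | n + 1, [_], h => by simp at h

theorem length_dynkinWord {L : Type*} (x y : L) {k : ℕ} (rs : Fin k → ℕ × ℕ) :
    (dynkinWord x y rs).length = ∑ i, ((rs i).1 + (rs i).2) := by
  simp [dynkinWord, List.length_flatMap, List.map_ofFn, List.sum_ofFn, Function.comp_def]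

theorem bchTerm_mem {L : Type*} [LieRing L] [LieAlgebra ℚ L] {n d : ℕ} (h : n + 1 ≤ d)
    (x y : L) : bchTerm d x y ∈ lLCS L n := by
  refine sum_mem fun k _ => sum_mem fun rs hrs => ?_
  refine (lLCS L n).smul_mem _ (rightNormed_mem n _ ?_)
  rw [length_dynkinWord, (Finset.mem_filter.1 hrs).2.2]
  exact h

/-- The terms of degree greater than `m` vanish in `L / lLCS L m`. -/
theorem bchPartial_quotient (L : Type*) [LieRing L] [LieAlgebra ℚ L] {m n : ℕ} (h : m ≤ n)
    (x y : L ⧸ lLCS L m) : bchPartial n x y = bchPartial m x y := by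
  obtain ⟨a, rfl⟩ := LieSubmodule.Quotient.surjective_mk' (lLCS L m) x
  obtain ⟨b, rfl⟩ := LieSubmodule.Quotient.surjective_mk' (lLCS L m) y
  refine (Finset.sum_subset (Finset.Icc_subset_Icc_right h) fun d hd hd' => ?_).symm
  have hd1 : m + 1 ≤ d := by
    simp only [Finset.mem_Icc] at hd hd'
    omega
  let π : L →ₗ⁅ℚ⁆ (L ⧸ lLCS L m) :=
    { (lLCS L m).toSubmodule.mkQ with map_lie' := rfl }
  have e : π (bchTerm d a b) = bchTerm d (π a) (π b) := bchTerm_map π d a b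
  have z : π (bchTerm d a b) = 0 := (Submodule.Quotient.mk_eq_zero _).2 (bchTerm_mem hd1 a b)
  exact e.symm.trans z

/-- The Baker–Campbell–Hausdorff product `x * y = ∑_d bchTerm d x y` on the pronilpotent completion
of `L`. Its component in the nilpotent Lie algebra `L / lLCS L n` is the series up to degree `n`,
all terms of higher degree being zero there. -/
noncomputable def bch {L : Type*} [LieRing L] [LieAlgebra ℚ L]
    (x y : PronilpotentCompletion L) : PronilpotentCompletion L :=
  ⟨fun n => bchPartial n (x.1 n) (y.1 n), fun m n h => by
    rw [bchPartial_map, x.2 m n h, y.2 m n h, bchPartial_quotient L h]⟩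

/-- `z` is the Baker–Campbell–Hausdorff product of `x` and `y` in the Lie algebra `M`: it is the
sum of the series for the topology given by the lower central series. -/
def IsBCHProduct {M : Type*} [LieRing M] [LieAlgebra ℚ M] (x y z : M) : Prop :=
  ∀ n : ℕ, z - bchPartial n x y ∈ lLCS M n

/-- The pronilpotent Lie algebra `M` is the Lie algebra associated with the Malcev group `Γ` by the
Malcev correspondence: there is an isomorphism from `Γ` to `M` with the Baker–Campbell–Hausdorff
product, and it identifies the nilpotent quotients `Γ / gLCS Γ n` and `M / lLCS M n`. -/
def IsAssociatedLieAlgebra (Γ M : Type*) [Group Γ] [LieRing M] [LieAlgebra ℚ M] : Prop :=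
  IsMalcevGroup Γ ∧ IsPronilpotent M ∧
    ∃ e : Γ ≃ M, (∀ g h : Γ, IsBCHProduct (e g) (e h) (e (g * h))) ∧
      ∀ (n : ℕ) (g h : Γ), g⁻¹ * h ∈ gLCS Γ n ↔ e g - e h ∈ lLCS M n

end BCH

/-! ### The rational lamplighter Lie algebra -/

section LamplighterLie

/- For a commutative ring the commutator bracket is zero, so this makes `ℚ[X]` and `ℚ` abelian Lie
algebras. -/
attribute [local instance] LieRing.ofAssociativeRing

/-- The action of `ℚ t` on the abelian Lie algebra `ℚ[X]`: `[c t, p] = - c X p`. -/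
noncomputable def lamplighterAction : ℚ →ₗ⁅ℚ⁆ LieDerivation ℚ ℚ[X] ℚ[X] where
  toFun c :=
    { toLinearMap := -(c • LinearMap.mulLeft ℚ (X : ℚ[X]))
      leibniz' := fun p q => by
        simp only [LieRing.of_associative_ring_bracket]
        simp [mul_comm] }
  map_add' c d := by
    ext p
    simp [add_smul]
    ring
  map_smul' c d := by
    ext p
    simp [mul_smul]
  map_lie' := fun {c d} => by
    ext p
    simp [LieRing.of_associative_ring_bracket]
    ring

/-- The rational lamplighter Lie algebra `ℚ[X] ⋊ ℚ t`; the element `p + c t` is `⟨p, c⟩`. -/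
abbrev LamplighterLie : Type :=
  LieAlgebra.SemiDirectSum ℚ[X] ℚ lamplighterAction

/-- The defining relation `[p, t] = X p`. -/
theorem lamplighterLie_bracket (p : ℚ[X]) :
    ⁅(⟨p, 0⟩ : LamplighterLie), (⟨0, 1⟩ : LamplighterLie)⁆ = ⟨X * p, 0⟩ := by
  rw [LieAlgebra.SemiDirectSum.lie_eq_mk]
  simp [lamplighterAction, LieRing.of_associative_ring_bracket]

end LamplighterLie

end Lamplighter

/-! Both sides are compared with one explicit matrix group. Sending p + ct to the matrix !![-cX, p;
0, 0] represents the lamplighter Lie algebra faithfully; in its pronilpotent completion p becomes a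
power series. The exponential of this matrix is !![e^{-cX}, f; 0, 1] with f = p · (e^{-cX} -
1)/(-cX), the quotient being read as 1 when c = 0. This factor is a unit of `ℚ⟦X⟧`, so
exponentiation is a bijection onto the group `ExpAffine`, with inverse `logEquiv`.

On the group side, a commutator with `⟨0, 1⟩` multiplies a series by 1 - e^{-X}, which is X times a
unit. The lower central series of `ExpAffine` is therefore X-adic, and `ExpAffine` is a Malcev
group. In the lamplighter group each lower central quotient after the first is generated by one
iterated commutator [[a, b], ..., b], whose image has leading coefficient 1; this makes
`toExpAffine` a Malcev completion. Any other completion is isomorphic to it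
(`IsMalcevCompletion.nonempty_mulEquiv`): in a product of nilpotent quotients, the pairs with a
power coming from G form a subgroup, which is the graph of an isomorphism.

On the Lie side, Dynkin's series has to be summed. Adjoin a formal element E with [z, E] = z for
each letter z. A right-normed bracket is then a product of left bracketings applied to E, hence an
entry of a product of the matrices `letterMat`, and Dynkin's sum becomes a coefficient of the
logarithm of a product of exponentials. Since E measures degree, the relevant entry is Xζ', where ζ
is the expected series `bchSeries`; Dynkin's factor 1/d undoes the differentiation
(`dynkinSum_letterMat`). The resulting closed form `bch_complElt` agrees with matrix multiplication
(`logEquiv_mul`). -/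

namespace Lamplighter

/-! ### Lower central series and roots in nilpotent groups. -/

section GroupGeneralities

open scoped commutatorElement

theorem commute_mk_of_mem_gLCS {G : Type*} [Group G] {n : ℕ} {z : G} (hz : z ∈ gLCS G n)
    (g : G) : Commute (z : G ⧸ gLCS G (n + 1)) g := by
  rw [← commutatorElement_eq_one_iff_commute]
  exact (QuotientGroup.eq_one_iff _).2
    (Subgroup.commutator_mem_commutator hz (Subgroup.mem_top g))

/-- Commutators of elements of `K` with `G` already lie in the smaller term, hence in `K`. -/
theorem normal_of_gLCS_le {G : Type*} [Group G] {n : ℕ} {K : Subgroup G}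
    (h : gLCS G (n + 1) ≤ K) (h' : K ≤ gLCS G n) : K.Normal where
  conj_mem k hk g := by
    have h1 : ⁅k, g⁆ ∈ K :=
      h (Subgroup.commutator_mem_commutator (h' hk) (Subgroup.mem_top g))
    have h2 : g * k * g⁻¹ = ⁅k, g⁆⁻¹ * k := by simp [commutatorElement_def, mul_assoc]
    rw [h2]
    exact mul_mem (inv_mem h1) hk

/-- The elements that commute with `z` modulo `K`. -/
def centralizerMod {G : Type*} [Group G] (K : Subgroup G) [K.Normal] (z : G) : Subgroup G :=
  (Subgroup.centralizer {(z : G ⧸ K)}).comap (QuotientGroup.mk' K)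

theorem mem_centralizerMod {G : Type*} [Group G] {K : Subgroup G} [K.Normal] {z g : G} :
    g ∈ centralizerMod K z ↔ ⁅z, g⁆ ∈ K := by
  unfold centralizerMod
  rw [← QuotientGroup.eq_one_iff (N := K), Subgroup.mem_comap,
    Subgroup.mem_centralizer_singleton_iff,
    show ((⁅z, g⁆ : G) : G ⧸ K) = ⁅(z : G ⧸ K), (g : G ⧸ K)⁆ from rfl,
    commutatorElement_eq_one_iff_mul_comm]
  exact eq_comm

theorem mem_centralizerMod' {G : Type*} [Group G] {K : Subgroup G} [K.Normal] {z g : G} :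
    g ∈ centralizerMod K z ↔ ⁅g, z⁆ ∈ K := by
  rw [mem_centralizerMod, ← commutatorElement_inv, inv_mem_iff]

/-- It suffices to check commutators with generators. -/
theorem commutator_top_le_of_closure {G : Type*} [Group G] {A K : Subgroup G} [K.Normal]
    {S : Set G} (hS : Subgroup.closure S = ⊤) (h : ∀ z ∈ A, ∀ s ∈ S, ⁅z, s⁆ ∈ K) :
    ⁅A, (⊤ : Subgroup G)⁆ ≤ K := by
  rw [Subgroup.commutator_le]
  intro z hz g _
  have : Subgroup.closure S ≤ centralizerMod K z :=
    (Subgroup.closure_le _).2 fun s hs => mem_centralizerMod.2 (h z hz s hs)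
  rw [hS] at this
  exact mem_centralizerMod.1 (this (Subgroup.mem_top g))

theorem commutatorElement_pow_pow {G : Type*} [Group G] {x y : G}
    (h : ∀ g, Commute ⁅x, y⁆ g) (k l : ℕ) : ⁅x ^ k, y ^ l⁆ = ⁅x, y⁆ ^ (k * l) := by
  have h1 : x * y * x⁻¹ = ⁅x, y⁆ * y := by simp [commutatorElement_def]
  have h2 : ∀ l : ℕ, x * y ^ l * x⁻¹ = ⁅x, y⁆ ^ l * y ^ l := fun l => by
    rw [← conj_pow, h1, (h y).mul_pow]
  have h3 : ∀ k : ℕ, x ^ k * y ^ l * (x ^ k)⁻¹ = ⁅x, y⁆ ^ (k * l) * y ^ l := by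
    intro k
    induction k with
    | zero => simp
    | succ k ih =>
      have e : x ^ (k + 1) * y ^ l * (x ^ (k + 1))⁻¹ = x * (x ^ k * y ^ l * (x ^ k)⁻¹) * x⁻¹ := by
        rw [pow_succ']; group
      have e2 : x * (⁅x, y⁆ ^ (k * l) * y ^ l) * x⁻¹
          = ⁅x, y⁆ ^ (k * l) * (x * y ^ l * x⁻¹) := by
        rw [← mul_assoc, ← (Commute.pow_left (h x) (k * l)).eq]; group
      rw [e, ih, e2, h2, ← mul_assoc, ← pow_add]
      congr 2
      ring
  rw [commutatorElement_def, h3]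
  group

/-- The elements of `gLCS G n` that have a power in `H` modulo `gLCS G (n + 1)`. -/
def relIsolator {G : Type*} [Group G] (H : Subgroup G) (n : ℕ) : Subgroup G where
  carrier := {z | z ∈ gLCS G n ∧ ∃ k : ℕ, 0 < k ∧ ∃ h ∈ H, h ∈ gLCS G n ∧
    (z : G ⧸ gLCS G (n + 1)) ^ k = h}
  one_mem' := ⟨one_mem _, 1, one_pos, 1, one_mem _, one_mem _, pow_one _⟩
  mul_mem' := by
    rintro z w ⟨hz, k, hk, h, hh, hh', e⟩ ⟨hw, l, hl, g, hg, hg', e'⟩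
    refine ⟨mul_mem hz hw, k * l, Nat.mul_pos hk hl, h ^ l * g ^ k,
      mul_mem (pow_mem hh _) (pow_mem hg _), mul_mem (pow_mem hh' _) (pow_mem hg' _), ?_⟩
    rw [QuotientGroup.mk_mul, (commute_mk_of_mem_gLCS hz w).mul_pow, pow_mul, e, mul_comm k l,
      pow_mul, e']
    rfl
  inv_mem' := by
    rintro z ⟨hz, k, hk, h, hh, hh', e⟩
    refine ⟨inv_mem hz, k, hk, h⁻¹, inv_mem hh, inv_mem hh', ?_⟩
    rw [QuotientGroup.mk_inv, inv_pow, e]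
    rfl

/-- Commutators are bimultiplicative modulo the next term: if z^k is congruent to u ∈ H and s^l ∈ H,
then ⁅z, s⁆^{kl} is congruent to ⁅u, s^l⁆ ∈ H. This carries the property from one term of the series
to the next. -/
theorem relIsolator_eq {G : Type*} [Group G] {H : Subgroup G} {S : Set G}
    (hS : Subgroup.closure S = ⊤) (h : ∀ s ∈ S, ∃ k : ℕ, 0 < k ∧ s ^ k ∈ H) (n : ℕ) :
    relIsolator H n = gLCS G n := by
  induction n with
  | zero =>
    refine le_antisymm (fun z hz => hz.1) ?_
    rw [gLCS, Subgroup.lowerCentralSeries_zero, ← hS, Subgroup.closure_le]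
    intro s hs
    obtain ⟨k, hk, hsk⟩ := h s hs
    exact ⟨Subgroup.mem_top _, k, hk, s ^ k, hsk, Subgroup.mem_top _, rfl⟩
  | succ n ih =>
    have hle : relIsolator H (n + 1) ≤ gLCS G (n + 1) := fun z hz => hz.1
    have hge : gLCS G (n + 2) ≤ relIsolator H (n + 1) := fun z hz =>
      ⟨gLCS_antitone G (Nat.le_succ _) hz, 1, one_pos, 1, one_mem _, one_mem _, by
        rw [pow_one]; exact (QuotientGroup.eq_one_iff _).2 hz⟩
    have := normal_of_gLCS_le hge hle
    refine le_antisymm hle ?_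
    refine commutator_top_le_of_closure hS fun z hz s hs => ?_
    have hzs : ⁅z, s⁆ ∈ gLCS G (n + 1) :=
      Subgroup.commutator_mem_commutator hz (Subgroup.mem_top s)
    obtain ⟨hz, k, hk, u, hu, hu', e⟩ := ih.ge hz
    obtain ⟨l, hl, hsl⟩ := h s hs
    refine ⟨hzs, k * l, Nat.mul_pos hk hl, ⁅u, s ^ l⁆, ?_,
      Subgroup.commutator_mem_commutator hu' (Subgroup.mem_top _), ?_⟩
    · rw [commutatorElement_def]
      exact mul_mem (mul_mem (mul_mem hu hsl) (inv_mem hu)) (inv_mem hsl)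
    · have h1 := commutatorElement_pow_pow (x := (z : G ⧸ gLCS G (n + 2))) (y := (s : G ⧸ _))
        (fun g => by
          induction g using QuotientGroup.induction_on with
          | H g => exact commute_mk_of_mem_gLCS hzs g) k l
      -- The discrepancy between `z ^ k` and `u` is central modulo `gLCS G (n + 2)`, so it drops out
      -- of the commutator.
      have h2 : u⁻¹ * z ^ k ∈ gLCS G (n + 1) := QuotientGroup.eq.1 e.symm
      have h3 := commute_mk_of_mem_gLCS h2 (s ^ l)
      have h4 : ((z : G ⧸ gLCS G (n + 2))) ^ k = u * ((u⁻¹ * z ^ k : G) : G ⧸ gLCS G (n + 2)) := by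
        rw [← QuotientGroup.mk_mul, mul_inv_cancel_left]; rfl
      rw [show ((⁅z, s⁆ : G) : G ⧸ gLCS G (n + 2)) = ⁅(z : G ⧸ gLCS G (n + 2)), (s : G ⧸ _)⁆
        from rfl, ← h1, h4]
      rw [show ((⁅u, s ^ l⁆ : G) : G ⧸ gLCS G (n + 2)) =
        ⁅(u : G ⧸ gLCS G (n + 2)), ((s ^ l : G) : G ⧸ _)⁆ from rfl, ← QuotientGroup.mk_pow]
      generalize ((u⁻¹ * z ^ k : G) : G ⧸ gLCS G (n + 2)) = r at h3
      rw [commutatorElement_def, commutatorElement_def, mul_assoc (u : G ⧸ _) r, h3.eq]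
      group

/-- If `G` is generated by elements that have a power in `H`, then every element of `G` has a
power in `H` modulo `gLCS G n`. -/
theorem exists_pow_mk_eq {G : Type*} [Group G] {H : Subgroup G} {S : Set G}
    (hS : Subgroup.closure S = ⊤) (h : ∀ s ∈ S, ∃ k : ℕ, 0 < k ∧ s ^ k ∈ H) (n : ℕ) (z : G) :
    ∃ k : ℕ, 0 < k ∧ ∃ u ∈ H, (z : G ⧸ gLCS G n) ^ k = u := by
  induction n with
  | zero =>
    refine ⟨1, one_pos, 1, one_mem _, ?_⟩
    exact QuotientGroup.eq.2 (Subgroup.mem_top _)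
  | succ n ih =>
    obtain ⟨k, hk, u, hu, e⟩ := ih
    have h2 : u⁻¹ * z ^ k ∈ gLCS G n := QuotientGroup.eq.1 e.symm
    -- The error of the approximation `z ^ k ≡ u` is central modulo the next term, and a further
    -- power moves it into `H`.
    obtain ⟨-, l, hl, v, hv, -, e'⟩ := (relIsolator_eq hS h n).ge h2
    refine ⟨k * l, Nat.mul_pos hk hl, u ^ l * v, mul_mem (pow_mem hu _) hv, ?_⟩
    have h4 : ((z : G ⧸ gLCS G (n + 1))) ^ k = u * ((u⁻¹ * z ^ k : G) : G ⧸ gLCS G (n + 1)) := by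
      rw [← QuotientGroup.mk_mul, mul_inv_cancel_left]; rfl
    rw [pow_mul, h4, ((commute_mk_of_mem_gLCS h2 u).symm).mul_pow, e']
    rfl

/-- The isolator of a subgroup of a nilpotent group. -/
def isolator {P : Type*} [Group P] (H : Subgroup P) {n : ℕ} (hP : gLCS P n = ⊥) :
    Subgroup P where
  carrier := {p | ∃ k : ℕ, 0 < k ∧ p ^ k ∈ H}
  one_mem' := ⟨1, one_pos, by simp [one_mem]⟩
  inv_mem' := by
    rintro p ⟨k, hk, h⟩
    exact ⟨k, hk, by rw [inv_pow]; exact inv_mem h⟩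
  mul_mem' := by
    rintro p q hp hq
    -- Inside the subgroup generated by `p` and `q` the generators have powers in `H`, and the
    -- `n`-th term of its lower central series is still trivial.
    let S : Set P := {p, q}
    let N := Subgroup.closure S
    have hpN : p ∈ N := Subgroup.subset_closure (by simp [S])
    have hqN : q ∈ N := Subgroup.subset_closure (by simp [S])
    have h1 : Subgroup.closure (((↑) : N → P) ⁻¹' S) = ⊤ :=
      Subgroup.closure_closure_coe_preimage
    obtain ⟨k, hk, u, hu, e⟩ := exists_pow_mk_eq (H := H.subgroupOf N) h1 (by
      rintro ⟨s, hs⟩ hsS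
      have hsS' : s = p ∨ s = q := hsS
      have : ∃ k : ℕ, 0 < k ∧ s ^ k ∈ H := by
        rcases hsS' with h | h
        · exact h ▸ hp
        · exact h ▸ hq
      exact this) n (⟨p, hpN⟩ * ⟨q, hqN⟩)
    refine ⟨k, hk, ?_⟩
    have h2 : u⁻¹ * (⟨p, hpN⟩ * ⟨q, hqN⟩) ^ k ∈ gLCS N n := QuotientGroup.eq.1 e.symm
    have h3 := map_gLCS_le N.subtype n (Subgroup.mem_map_of_mem _ h2)
    rw [hP, Subgroup.mem_bot, map_mul, map_inv, inv_mul_eq_one] at h3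
    have h4 : (p * q) ^ k = (u : P) := h3.symm
    rw [h4]
    exact hu

theorem gLCS_quotient_eq_bot (G : Type*) [Group G] (n : ℕ) : gLCS (G ⧸ gLCS G n) n = ⊥ := by
  have h := Subgroup.map_lowerCentralSeries (QuotientGroup.mk' (gLCS G n)) (S := ⊤) n
  rw [Subgroup.map_top_of_surjective _ (QuotientGroup.mk'_surjective _)] at h
  change Subgroup.lowerCentralSeries ⊤ n = ⊥
  rw [← h, Subgroup.map_eq_bot_iff, QuotientGroup.ker_mk']

theorem gLCS_prod_eq_bot {P Q : Type*} [Group P] [Group Q] {n : ℕ} (hP : gLCS P n = ⊥)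
    (hQ : gLCS Q n = ⊥) : gLCS (P × Q) n = ⊥ := by
  rw [eq_bot_iff]
  rintro ⟨p, q⟩ h
  have h1 := map_gLCS_le (MonoidHom.fst P Q) n (Subgroup.mem_map_of_mem _ h)
  have h2 := map_gLCS_le (MonoidHom.snd P Q) n (Subgroup.mem_map_of_mem _ h)
  rw [hP, Subgroup.mem_bot] at h1
  rw [hQ, Subgroup.mem_bot] at h2
  exact Prod.ext h1 h2

end GroupGeneralities

/-! ### Malcev groups: torsion, divisibility, rational graded isomorphisms. -/

section MalcevGroups

open scoped commutatorElement

theorem gr_mk_eq_one_iff {G : Type*} [Group G] {n : ℕ} (x : gLCS G n) :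
    (QuotientGroup.mk x : Gr G n) = 1 ↔ (x : G) ∈ gLCS G (n + 1) := by
  rw [QuotientGroup.eq_one_iff, Subgroup.mem_subgroupOf]

theorem gr_mk_pow_eq_iff {G : Type*} [Group G] {n : ℕ} (x y : gLCS G n) (k : ℕ) :
    (QuotientGroup.mk x : Gr G n) ^ k = QuotientGroup.mk y ↔
      ((y : G)⁻¹ * (x : G) ^ k) ∈ gLCS G (n + 1) := by
  rw [← QuotientGroup.mk_pow, eq_comm, QuotientGroup.eq, Subgroup.mem_subgroupOf]
  rfl

theorem gr_mk_zpow_eq_iff {G : Type*} [Group G] {n : ℕ} (x y : gLCS G n) (k : ℤ) :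
    (QuotientGroup.mk x : Gr G n) ^ k = QuotientGroup.mk y ↔
      ((y : G)⁻¹ * (x : G) ^ k) ∈ gLCS G (n + 1) := by
  rw [← QuotientGroup.mk_zpow, eq_comm, QuotientGroup.eq, Subgroup.mem_subgroupOf]
  rfl

theorem IsMalcevGroup.mem_gLCS_succ {Γ : Type*} [Group Γ] (h : IsMalcevGroup Γ) {n k : ℕ}
    (hk : 0 < k) {x : Γ} (hx : x ∈ gLCS Γ n) (hxk : x ^ k ∈ gLCS Γ (n + 1)) :
    x ∈ gLCS Γ (n + 1) := by
  obtain ⟨inst⟩ := h.1 n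
  let y : Gr Γ n := QuotientGroup.mk ⟨x, hx⟩
  have h1 : y ^ k = 1 := (gr_mk_pow_eq_iff ⟨x, hx⟩ 1 k).2 (by simpa using hxk)
  have h2 : (k : ℚ) • (Additive.ofMul y) = 0 := by
    rw [Nat.cast_smul_eq_nsmul, ← ofMul_pow, h1]
    rfl
  rcases smul_eq_zero.1 h2 with h3 | h3
  · exact absurd h3 (Nat.cast_ne_zero.2 hk.ne')
  · exact (gr_mk_eq_one_iff ⟨x, hx⟩).1 h3

theorem IsMalcevGroup.mem_gLCS_of_pow {Γ : Type*} [Group Γ] (h : IsMalcevGroup Γ) {n k : ℕ}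
    (hk : 0 < k) {x : Γ} (hxk : x ^ k ∈ gLCS Γ n) : x ∈ gLCS Γ n := by
  suffices ∀ m ≤ n, x ∈ gLCS Γ m from this n le_rfl
  intro m
  induction m with
  | zero => exact fun _ => Subgroup.mem_top x
  | succ m ih =>
    intro hm
    exact h.mem_gLCS_succ hk (ih (Nat.le_of_succ_le hm)) (gLCS_antitone Γ hm hxk)

/-- A root modulo `gLCS Γ n` is corrected to the next level: its error lies in a divisible quotient
that is central modulo `gLCS Γ (n + 1)`. -/
theorem IsMalcevGroup.exists_pow_eq {Γ : Type*} [Group Γ] (h : IsMalcevGroup Γ) {k : ℕ}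
    (hk : 0 < k) (n : ℕ) (x : Γ) : ∃ y : Γ, (y : Γ ⧸ gLCS Γ n) ^ k = x := by
  induction n with
  | zero => exact ⟨1, QuotientGroup.eq.2 (Subgroup.mem_top _)⟩
  | succ n ih =>
    obtain ⟨y, hy⟩ := ih
    have h1 : (y ^ k)⁻¹ * x ∈ gLCS Γ n := QuotientGroup.eq.1 hy
    obtain ⟨inst⟩ := h.1 n
    let r : Gr Γ n := QuotientGroup.mk ⟨_, h1⟩
    obtain ⟨⟨w, hw⟩, hw'⟩ := QuotientGroup.mk_surjective
      (Additive.toMul ((k : ℚ)⁻¹ • Additive.ofMul r) : Gr Γ n)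
    have h2 : (QuotientGroup.mk ⟨w, hw⟩ : Gr Γ n) ^ k = r := by
      have h3 : k • ((k : ℚ)⁻¹ • Additive.ofMul r) = Additive.ofMul r := by
        rw [← Nat.cast_smul_eq_nsmul ℚ, smul_inv_smul₀ (Nat.cast_ne_zero.2 hk.ne')]
      rw [hw']
      exact h3
    have h4 : ((y ^ k)⁻¹ * x)⁻¹ * w ^ k ∈ gLCS Γ (n + 1) := (gr_mk_pow_eq_iff _ _ k).1 h2
    refine ⟨y * w, ?_⟩
    rw [QuotientGroup.mk_mul, ((commute_mk_of_mem_gLCS hw y).symm).mul_pow]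
    refine (QuotientGroup.eq (s := gLCS Γ (n + 1)) (a := y ^ k * w ^ k) (b := x)).2 ?_
    have h5 := inv_mem h4
    rwa [mul_inv_rev, inv_inv, ← mul_assoc, ← mul_inv_rev] at h5

/-- The elementwise form of the condition that `η` induces isomorphisms
`(gLCS G n / gLCS G (n + 1)) ⊗ ℚ → gLCS Γ n / gLCS Γ (n + 1)`. -/
def IsRationalGrIso {G Γ : Type*} [Group G] [Group Γ] (η : G →* Γ) : Prop :=
  ∀ n : ℕ, (∀ g ∈ gLCS G n, η g ∈ gLCS Γ (n + 1) → ∃ k : ℕ, 0 < k ∧ g ^ k ∈ gLCS G (n + 1)) ∧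
    ∀ x ∈ gLCS Γ n, ∃ k : ℕ, 0 < k ∧ ∃ g ∈ gLCS G n, (η g)⁻¹ * x ^ k ∈ gLCS Γ (n + 1)

theorem grMap_mk_eq_one_iff {G Γ : Type*} [Group G] [Group Γ] (η : G →* Γ) {n : ℕ}
    (g : gLCS G n) : grMap η n (QuotientGroup.mk g) = 1 ↔ η g ∈ gLCS Γ (n + 1) :=
  gr_mk_eq_one_iff (⟨η g, map_gLCS_le η n (Subgroup.mem_map_of_mem η g.2)⟩ : gLCS Γ n)

/-- Base change from ℤ to ℚ is localization at the nonzero integers. Since the target is already a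
ℚ-vector space, the condition says that kernel and cokernel are torsion. -/
theorem isBaseChange_iff_of_module {G Γ : Type*} [Group G] [Group Γ] (η : G →* Γ) (n : ℕ)
    [Module ℚ (Additive (Gr Γ n))] : IsBaseChange ℚ (grLinearMap η n) ↔
      (∀ g ∈ gLCS G n, η g ∈ gLCS Γ (n + 1) → ∃ k : ℕ, 0 < k ∧ g ^ k ∈ gLCS G (n + 1)) ∧
      ∀ x ∈ gLCS Γ n, ∃ k : ℕ, 0 < k ∧ ∃ g ∈ gLCS G n, (η g)⁻¹ * x ^ k ∈ gLCS Γ (n + 1) := by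
  have natAbs_zpow : ∀ {H : Type _} [Group H] (K : Subgroup H) (x : H) (c : ℤ), x ^ c ∈ K →
      x ^ c.natAbs ∈ K := fun K x c h => by
    rcases Int.natAbs_eq c with hc | hc
    · rw [hc, zpow_natCast] at h; exact h
    · rw [hc, zpow_neg, zpow_natCast] at h; exact inv_mem_iff.1 h
  rw [← isLocalizedModule_iff_isBaseChange (nonZeroDivisors ℤ)]
  constructor
  · intro h
    constructor
    · intro g hg hη
      have h1 : grLinearMap η n (Additive.ofMul (QuotientGroup.mk ⟨g, hg⟩ : Gr G n)) = 0 :=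
        (grMap_mk_eq_one_iff η ⟨g, hg⟩).2 hη
      obtain ⟨⟨c, hc⟩, h2⟩ := (IsLocalizedModule.eq_zero_iff (nonZeroDivisors ℤ) _).1 h1
      refine ⟨c.natAbs, Int.natAbs_pos.2 (nonZeroDivisors.ne_zero hc), ?_⟩
      refine natAbs_zpow _ g c ?_
      simpa using (gr_mk_zpow_eq_iff ⟨g, hg⟩ 1 c).1 h2
    · intro x hx
      obtain ⟨⟨m, ⟨c, hc⟩⟩, h1⟩ := IsLocalizedModule.surj (nonZeroDivisors ℤ) (grLinearMap η n)
        (Additive.ofMul (QuotientGroup.mk ⟨x, hx⟩ : Gr Γ n))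
      obtain ⟨⟨g, hg⟩, hg'⟩ := QuotientGroup.mk_surjective (Additive.toMul m : Gr G n)
      have key : grMap η n (QuotientGroup.mk ⟨g, hg⟩) =
        (QuotientGroup.mk ⟨η g, map_gLCS_le η n (Subgroup.mem_map_of_mem η hg)⟩ : Gr Γ n) := rfl
      have h2 : (QuotientGroup.mk ⟨x, hx⟩ : Gr Γ n) ^ c =
          (QuotientGroup.mk ⟨η g, map_gLCS_le η n (Subgroup.mem_map_of_mem η hg)⟩ : Gr Γ n) := by
        rw [← key, hg']
        exact h1
      have h3 : (η g)⁻¹ * x ^ c ∈ gLCS Γ (n + 1) := (gr_mk_zpow_eq_iff _ _ c).1 h2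
      refine ⟨c.natAbs, Int.natAbs_pos.2 (nonZeroDivisors.ne_zero hc), ?_⟩
      rcases Int.natAbs_eq c with hc' | hc'
      · refine ⟨g, hg, ?_⟩
        rw [hc', zpow_natCast] at h3
        exact h3
      · refine ⟨g⁻¹, inv_mem hg, ?_⟩
        rw [hc', zpow_neg, zpow_natCast] at h3
        have h4 := inv_mem h3
        rw [mul_inv_rev] at h4
        replace h4 := (inferInstance : (gLCS Γ (n + 1)).Normal).mem_comm h4
        simpa using h4
  · rintro ⟨h1, h2⟩
    refine ⟨?_, ?_, ?_⟩
    · rintro ⟨c, hc⟩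
      have hc0 : (c : ℚ) ≠ 0 := Int.cast_ne_zero.2 (nonZeroDivisors.ne_zero hc)
      rw [Module.End.isUnit_iff]
      constructor
      · intro x y hxy
        have h3 : c • x = c • y := hxy
        rw [← Int.cast_smul_eq_zsmul ℚ, ← Int.cast_smul_eq_zsmul ℚ] at h3
        exact smul_right_injective _ hc0 h3
      · intro y
        refine ⟨(c : ℚ)⁻¹ • y, ?_⟩
        change c • ((c : ℚ)⁻¹ • y) = y
        rw [← Int.cast_smul_eq_zsmul ℚ, smul_inv_smul₀ hc0]
    · intro y
      obtain ⟨⟨x, hx⟩, hx'⟩ := QuotientGroup.mk_surjective (Additive.toMul y : Gr Γ n)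
      obtain ⟨k, hk, g, hg, h3⟩ := h2 x hx
      refine ⟨⟨Additive.ofMul (QuotientGroup.mk ⟨g, hg⟩ : Gr G n),
        ⟨k, mem_nonZeroDivisors_of_ne_zero (by exact_mod_cast hk.ne')⟩⟩, ?_⟩
      change (k : ℤ) • y = _
      rw [natCast_zsmul]
      have h4 : (QuotientGroup.mk ⟨x, hx⟩ : Gr Γ n) ^ k =
          grMap η n (QuotientGroup.mk ⟨g, hg⟩) :=
        (gr_mk_pow_eq_iff _ _ k).2 h3
      rw [hx'] at h4
      exact h4
    · intro x₁ x₂ h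
      obtain ⟨⟨g, hg⟩, hg'⟩ := QuotientGroup.mk_surjective (Additive.toMul (x₁ - x₂) : Gr G n)
      have h3 : grLinearMap η n (x₁ - x₂) = 0 := by rw [map_sub, h, sub_self]
      have h4 : grMap η n (QuotientGroup.mk ⟨g, hg⟩) = 1 := by rw [hg']; exact h3
      obtain ⟨k, hk, h5⟩ := h1 g hg ((grMap_mk_eq_one_iff η ⟨g, hg⟩).1 h4)
      refine ⟨⟨k, mem_nonZeroDivisors_of_ne_zero (by exact_mod_cast hk.ne')⟩, ?_⟩
      change (k : ℤ) • x₁ = (k : ℤ) • x₂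
      rw [← sub_eq_zero, ← smul_sub, natCast_zsmul]
      have h6 : (QuotientGroup.mk ⟨g, hg⟩ : Gr G n) ^ k = 1 :=
        (gr_mk_pow_eq_iff ⟨g, hg⟩ 1 k).2 (by simpa using h5)
      rw [hg'] at h6
      exact h6

end MalcevGroups

/-! ### Uniqueness of the Malcev completion. -/

section Uniqueness

theorem IsMalcevCompletion.isRationalGrIso {G Γ : Type*} [Group G] [Group Γ] {η : G →* Γ}
    (h : IsMalcevCompletion η) : IsRationalGrIso η := fun n => by
  obtain ⟨inst, h'⟩ := h.2 n
  exact (isBaseChange_iff_of_module η n).1 h'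

theorem IsMalcevGroup.isMalcevCompletion {G Γ : Type*} [Group G] [Group Γ] {η : G →* Γ}
    (h : IsMalcevGroup Γ) (h' : IsRationalGrIso η) : IsMalcevCompletion η := by
  refine ⟨h, fun n => ?_⟩
  obtain ⟨inst⟩ := h.1 n
  exact ⟨inst, (isBaseChange_iff_of_module η n).2 (h' n)⟩

theorem IsRationalGrIso.exists_pow_mem {G Γ : Type*} [Group G] [Group Γ] {η : G →* Γ}
    (h : IsRationalGrIso η) {n : ℕ} {g : G} (hg : η g ∈ gLCS Γ n) :
    ∃ k : ℕ, 0 < k ∧ g ^ k ∈ gLCS G n := by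
  suffices ∀ m ≤ n, ∃ k : ℕ, 0 < k ∧ g ^ k ∈ gLCS G m from this n le_rfl
  intro m
  induction m with
  | zero => exact fun _ => ⟨1, one_pos, Subgroup.mem_top _⟩
  | succ m ih =>
    intro hm
    obtain ⟨k, hk, h1⟩ := ih (Nat.le_of_succ_le hm)
    obtain ⟨l, hl, h2⟩ := (h m).1 (g ^ k) h1
      (by rw [map_pow]; exact pow_mem (gLCS_antitone Γ hm hg) k)
    exact ⟨k * l, Nat.mul_pos hk hl, by rwa [pow_mul]⟩

theorem IsRationalGrIso.exists_pow_eq {G Γ : Type*} [Group G] [Group Γ] {η : G →* Γ}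
    (h : IsRationalGrIso η) (n : ℕ) (x : Γ) :
    ∃ k : ℕ, 0 < k ∧ ∃ g : G, (x : Γ ⧸ gLCS Γ n) ^ k = η g := by
  induction n with
  | zero => exact ⟨1, one_pos, 1, QuotientGroup.eq.2 (Subgroup.mem_top _)⟩
  | succ n ih =>
    obtain ⟨k, hk, g, e⟩ := ih
    have h1 : (η g)⁻¹ * x ^ k ∈ gLCS Γ n := QuotientGroup.eq.1 e.symm
    obtain ⟨l, hl, g', -, h2⟩ := (h n).2 _ h1
    refine ⟨k * l, Nat.mul_pos hk hl, g ^ l * g', ?_⟩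
    have e' : (((η g)⁻¹ * x ^ k : Γ) : Γ ⧸ gLCS Γ (n + 1)) ^ l = η g' := (QuotientGroup.eq.2 h2).symm
    have h4 : ((x : Γ ⧸ gLCS Γ (n + 1))) ^ k =
        η g * (((η g)⁻¹ * x ^ k : Γ) : Γ ⧸ gLCS Γ (n + 1)) := by
      rw [← QuotientGroup.mk_mul, mul_inv_cancel_left]; rfl
    rw [pow_mul, h4, ((commute_mk_of_mem_gLCS h1 _).symm).mul_pow, e', map_mul, map_pow]
    rfl

/-- The root closure of the image of `G` in `Γ / gLCS Γ n × Γ' / gLCS Γ' n`. -/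
def comparison {G Γ Γ' : Type*} [Group G] [Group Γ] [Group Γ'] (η : G →* Γ) (η' : G →* Γ')
    (n : ℕ) : Subgroup ((Γ ⧸ gLCS Γ n) × (Γ' ⧸ gLCS Γ' n)) :=
  isolator (((QuotientGroup.mk' (gLCS Γ n)).comp η).prod
    ((QuotientGroup.mk' (gLCS Γ' n)).comp η')).range
    (gLCS_prod_eq_bot (gLCS_quotient_eq_bot Γ n) (gLCS_quotient_eq_bot Γ' n))

variable {G Γ Γ' : Type*} [Group G] [Group Γ] [Group Γ'] {η : G →* Γ} {η' : G →* Γ'}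

theorem mem_comparison {n : ℕ} {x : Γ ⧸ gLCS Γ n} {y : Γ' ⧸ gLCS Γ' n} :
    (x, y) ∈ comparison η η' n ↔
      ∃ k : ℕ, 0 < k ∧ ∃ g : G, x ^ k = (η g : Γ ⧸ gLCS Γ n) ∧ y ^ k = (η' g : Γ' ⧸ gLCS Γ' n) := by
  refine exists_congr fun k => and_congr_right fun _ => exists_congr fun g => ?_
  rw [Prod.ext_iff]
  exact and_congr eq_comm eq_comm

theorem mem_comparison_swap {n : ℕ} {x : Γ ⧸ gLCS Γ n} {y : Γ' ⧸ gLCS Γ' n} :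
    (x, y) ∈ comparison η η' n ↔ (y, x) ∈ comparison η' η n := by
  simp only [mem_comparison, and_comm]

theorem comparison_of_le {m n : ℕ} (h : m ≤ n) {x : Γ} {y : Γ'}
    (hxy : ((x : Γ ⧸ gLCS Γ n), (y : Γ' ⧸ gLCS Γ' n)) ∈ comparison η η' n) :
    ((x : Γ ⧸ gLCS Γ m), (y : Γ' ⧸ gLCS Γ' m)) ∈ comparison η η' m := by
  rw [mem_comparison] at hxy ⊢
  obtain ⟨k, hk, g, e, e'⟩ := hxy
  refine ⟨k, hk, g, ?_, ?_⟩
  · have := congrArg (gTransition Γ h) e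
    rwa [map_pow] at this
  · have := congrArg (gTransition Γ' h) e'
    rwa [map_pow] at this

/-- If g becomes trivial in `Γ / gLCS Γ n`, then a power of g lies in `gLCS G n` and dies in the
quotient of `Γ'` too; that quotient has no torsion. This makes the relation single-valued. -/
theorem eq_one_of_comparison (hη : IsRationalGrIso η) (hΓ' : IsMalcevGroup Γ') {n : ℕ} {y : Γ'}
    (h : (1, (y : Γ' ⧸ gLCS Γ' n)) ∈ comparison η η' n) : (y : Γ' ⧸ gLCS Γ' n) = 1 := by
  obtain ⟨k, hk, g, e, e'⟩ := mem_comparison.1 h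
  rw [one_pow] at e
  obtain ⟨l, hl, h1⟩ := hη.exists_pow_mem ((QuotientGroup.eq_one_iff _).1 e.symm)
  rw [QuotientGroup.eq_one_iff]
  refine hΓ'.mem_gLCS_of_pow (Nat.mul_pos hk hl) ((QuotientGroup.eq_one_iff _).1 ?_)
  rw [QuotientGroup.mk_pow, pow_mul, e', ← QuotientGroup.mk_pow, QuotientGroup.eq_one_iff,
    ← map_pow]
  exact map_gLCS_le η' n (Subgroup.mem_map_of_mem η' h1)

theorem eq_of_comparison (hη : IsRationalGrIso η) (hΓ' : IsMalcevGroup Γ') {n : ℕ} {x : Γ}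
    {y z : Γ'} (hy : ((x : Γ ⧸ gLCS Γ n), (y : Γ' ⧸ gLCS Γ' n)) ∈ comparison η η' n)
    (hz : ((x : Γ ⧸ gLCS Γ n), (z : Γ' ⧸ gLCS Γ' n)) ∈ comparison η η' n) :
    (y : Γ' ⧸ gLCS Γ' n) = z := by
  have h := mul_mem (inv_mem hy) hz
  rw [Prod.inv_mk, Prod.mk_mul_mk, inv_mul_cancel, ← QuotientGroup.mk_inv,
    ← QuotientGroup.mk_mul] at h
  have h1 := eq_one_of_comparison hη hΓ' h
  rw [QuotientGroup.mk_mul, QuotientGroup.mk_inv, inv_mul_eq_one] at h1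
  exact h1

theorem IsMalcevGroup.eq_of_forall {Γ : Type*} [Group Γ] (h : IsMalcevGroup Γ) {x y : Γ}
    (hxy : ∀ n, (x : Γ ⧸ gLCS Γ n) = y) : x = y :=
  h.2.1 (Subtype.ext (funext hxy))

/-- A power x^k comes from some g ∈ G, and a k-th root of `η' g` is a partner of x at level n.
Partners are unique at each level, hence compatible, and completeness of `Γ'` assembles them. -/
theorem exists_comparison (hη : IsMalcevCompletion η) (hη' : IsMalcevCompletion η') (x : Γ) :
    ∃ y : Γ', ∀ n : ℕ, ((x : Γ ⧸ gLCS Γ n), (y : Γ' ⧸ gLCS Γ' n)) ∈ comparison η η' n := by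
  have h1 : ∀ n : ℕ, ∃ y : Γ', ((x : Γ ⧸ gLCS Γ n), (y : Γ' ⧸ gLCS Γ' n)) ∈ comparison η η' n := by
    intro n
    obtain ⟨k, hk, g, e⟩ := hη.isRationalGrIso.exists_pow_eq n x
    obtain ⟨y, e'⟩ := hη'.1.exists_pow_eq hk n (η' g)
    exact ⟨y, mem_comparison.2 ⟨k, hk, g, e, e'⟩⟩
  choose y hy using h1
  obtain ⟨z, hz⟩ := hη'.1.2.2 ⟨fun n => (y n : Γ' ⧸ gLCS Γ' n), fun m n h =>
    eq_of_comparison hη.isRationalGrIso hη'.1 (comparison_of_le h (hy n)) (hy m)⟩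
  refine ⟨z, fun n => ?_⟩
  have h2 : (z : Γ' ⧸ gLCS Γ' n) = y n := congrFun (congrArg Subtype.val hz) n
  rw [h2]
  exact hy n

/-- Two Malcev completions of a group are isomorphic. -/
theorem IsMalcevCompletion.nonempty_mulEquiv (hη : IsMalcevCompletion η)
    (hη' : IsMalcevCompletion η') : Nonempty (Γ ≃* Γ') := by
  choose F hF using exists_comparison hη hη'
  choose F' hF' using exists_comparison hη' hη
  have uniq : ∀ (x : Γ) (y z : Γ'),
      (∀ n : ℕ, ((x : Γ ⧸ gLCS Γ n), (y : Γ' ⧸ gLCS Γ' n)) ∈ comparison η η' n) →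
      (∀ n : ℕ, ((x : Γ ⧸ gLCS Γ n), (z : Γ' ⧸ gLCS Γ' n)) ∈ comparison η η' n) → y = z :=
    fun x y z hy hz => hη'.1.eq_of_forall fun n =>
      eq_of_comparison hη.isRationalGrIso hη'.1 (hy n) (hz n)
  exact ⟨{ toFun := F
           invFun := F'
           left_inv := fun x => hη.1.eq_of_forall fun n =>
            eq_of_comparison hη'.isRationalGrIso hη.1 (hF' (F x) n)
              (mem_comparison_swap.1 (hF x n))
           right_inv := fun y => hη'.1.eq_of_forall fun n =>
            eq_of_comparison hη.isRationalGrIso hη'.1 (hF (F' y) n)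
              (mem_comparison_swap.1 (hF' y n))
           map_mul' := fun x y => uniq (x * y) _ _ (hF _) fun n => mul_mem (hF x n) (hF y n) }⟩

end Uniqueness

/-! ### Exponential series and their difference quotients. -/

section ExponentialSeries

open scoped PowerSeries

/-- The power series `e^{cX}`. -/
noncomputable def expSeries (c : ℚ) : ℚ⟦X⟧ := PowerSeries.rescale c (PowerSeries.exp ℚ)

/-- The power series `(e^{cX} - 1) / (cX)`. -/
noncomputable def expQuot (c : ℚ) : ℚ⟦X⟧ :=
  PowerSeries.mk fun n => c ^ n / ((n + 1)! : ℚ)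

theorem coeff_expSeries (c : ℚ) (n : ℕ) : PowerSeries.coeff n (expSeries c) = c ^ n / (n ! : ℚ) := by
  simp [expSeries, PowerSeries.coeff_rescale, PowerSeries.coeff_exp, div_eq_mul_inv]

theorem expSeries_add (c d : ℚ) : expSeries (c + d) = expSeries c * expSeries d :=
  (PowerSeries.exp_mul_exp_eq_exp_add c d).symm

theorem expSeries_zero : expSeries 0 = 1 := by
  ext n
  rw [coeff_expSeries, PowerSeries.coeff_one]
  cases n <;> simp

theorem constantCoeff_expSeries (c : ℚ) : PowerSeries.constantCoeff (expSeries c) = 1 := by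
  rw [← PowerSeries.coeff_zero_eq_constantCoeff_apply, coeff_expSeries]
  simp

theorem expSeries_neg_mul_expSeries (c : ℚ) : expSeries (-c) * expSeries c = 1 := by
  rw [← expSeries_add, neg_add_cancel, expSeries_zero]

theorem isUnit_expSeries (c : ℚ) : IsUnit (expSeries c) :=
  .of_mul_eq_one _ ((mul_comm _ _).trans (expSeries_neg_mul_expSeries c))

theorem constantCoeff_expQuot (c : ℚ) : PowerSeries.constantCoeff (expQuot c) = 1 := by
  rw [← PowerSeries.coeff_zero_eq_constantCoeff_apply, expQuot, PowerSeries.coeff_mk]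
  simp

theorem isUnit_expQuot (c : ℚ) : IsUnit (expQuot c) := by
  rw [PowerSeries.isUnit_iff_constantCoeff, constantCoeff_expQuot]
  exact isUnit_one

/-- Multiplied out, so that `c = 0` needs no separate treatment. -/
theorem C_mul_X_mul_expQuot (c : ℚ) :
    PowerSeries.C c * PowerSeries.X * expQuot c = expSeries c - 1 := by
  ext n
  rw [mul_assoc, PowerSeries.coeff_C_mul, map_sub, coeff_expSeries, PowerSeries.coeff_one]
  cases n with
  | zero => simp
  | succ n => simp [PowerSeries.coeff_succ_X_mul, expQuot, pow_succ']; ring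

end ExponentialSeries

/-! ### The matrix group and its Malcev property. -/

section ExpAffine

open scoped PowerSeries commutatorElement

/-- The group of the matrices `!![e^{-cX}, f; 0, 1]` with `f ∈ ℚ⟦X⟧` and `c ∈ ℚ`. -/
@[ext]
structure ExpAffine where
  /-- The upper right entry `f`. -/
  ser : ℚ⟦X⟧
  /-- The exponent `c`. -/
  scal : ℚ

namespace ExpAffine

noncomputable instance : Mul ExpAffine :=
  ⟨fun x y => ⟨x.ser + expSeries (-x.scal) * y.ser, x.scal + y.scal⟩⟩
noncomputable instance : One ExpAffine := ⟨⟨0, 0⟩⟩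
noncomputable instance : Inv ExpAffine := ⟨fun x => ⟨-(expSeries x.scal * x.ser), -x.scal⟩⟩

@[simp] theorem mul_ser (x y : ExpAffine) :
    (x * y).ser = x.ser + expSeries (-x.scal) * y.ser := rfl
@[simp] theorem mul_scal (x y : ExpAffine) : (x * y).scal = x.scal + y.scal := rfl
@[simp] theorem one_ser : (1 : ExpAffine).ser = 0 := rfl
@[simp] theorem one_scal : (1 : ExpAffine).scal = 0 := rfl
@[simp] theorem inv_ser (x : ExpAffine) : x⁻¹.ser = -(expSeries x.scal * x.ser) := rfl
@[simp] theorem inv_scal (x : ExpAffine) : x⁻¹.scal = -x.scal := rfl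

noncomputable instance : Group ExpAffine :=
  Group.ofLeftAxioms
    (fun x y z => by
      ext1
      · simp only [mul_ser, mul_scal, neg_add, expSeries_add]
        ring
      · simp only [mul_scal]
        ring)
    (fun x => by ext1 <;> simp [expSeries_zero])
    (fun x => by ext1 <;> simp)

theorem commutator_ser (x y : ExpAffine) : ⁅x, y⁆.ser =
    (1 - expSeries (-y.scal)) * x.ser - (1 - expSeries (-x.scal)) * y.ser := by
  have h1 := expSeries_neg_mul_expSeries x.scal
  have h2 := expSeries_neg_mul_expSeries y.scal
  simp only [commutatorElement_def, mul_ser, mul_scal, inv_ser, inv_scal, neg_add, expSeries_add,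
    neg_neg]
  linear_combination (-expSeries (-y.scal) * x.ser -
    y.ser * expSeries (-y.scal) * expSeries y.scal) *
    h1 - y.ser * h2

theorem commutator_scal (x y : ExpAffine) : ⁅x, y⁆.scal = 0 := by
  simp only [commutatorElement_def, mul_scal, inv_scal]
  ring

/-- The elements `⟨f, 0⟩` with `X ^ n ∣ f`. -/
noncomputable def level (n : ℕ) : Subgroup ExpAffine where
  carrier := {x | x.scal = 0 ∧ PowerSeries.X ^ n ∣ x.ser}
  one_mem' := ⟨rfl, dvd_zero _⟩
  mul_mem' := fun {x y} hx hy =>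
    ⟨by rw [mul_scal, hx.1, hy.1, add_zero], dvd_add hx.2 (hy.2.mul_left _)⟩
  inv_mem' := fun {x} hx =>
    ⟨by rw [inv_scal, hx.1, neg_zero], (dvd_neg.2 (hx.2.mul_left _))⟩

theorem X_dvd_one_sub_expSeries (c : ℚ) : PowerSeries.X ∣ 1 - expSeries c := by
  rw [PowerSeries.X_dvd_iff, map_sub, map_one, constantCoeff_expSeries, sub_self]

/-- Commutation with `⟨0, 1⟩` multiplies a series by 1 - e^{-X}, which is X times the unit `expQuot
(-1)`; dividing by X and by this unit gives the witness. -/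
theorem exists_eq_commutator {n : ℕ} {x : ExpAffine} (hx : x ∈ level (n + 1)) :
    ∃ f : ℚ⟦X⟧, PowerSeries.X ^ n ∣ f ∧ x = ⁅(⟨f, 0⟩ : ExpAffine), ⟨0, 1⟩⁆ := by
  obtain ⟨h0, g, hg⟩ := hx
  obtain ⟨u, hu⟩ := isUnit_expQuot (-1)
  refine ⟨PowerSeries.X ^ n * (g * ((u⁻¹ : ℚ⟦X⟧ˣ) : ℚ⟦X⟧)), dvd_mul_right _ _, ?_⟩
  ext1
  · have h1 := C_mul_X_mul_expQuot (-1)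
    have h2 : (u : ℚ⟦X⟧) * ((u⁻¹ : ℚ⟦X⟧ˣ) : ℚ⟦X⟧) = 1 := u.mul_inv
    rw [← hu, map_neg, map_one] at h1
    rw [commutator_ser, hg, mul_zero, sub_zero]
    linear_combination -PowerSeries.X ^ n * g * ((u⁻¹ : ℚ⟦X⟧ˣ) : ℚ⟦X⟧) * h1 -
      PowerSeries.X ^ (n + 1) * g * h2
  · rw [commutator_scal, h0]

/-- The index starts at `n + 1` because the whole group, unlike the levels, contains elements with
nonzero `scal`. -/
theorem gLCS_succ_eq_level (n : ℕ) : gLCS ExpAffine (n + 1) = level (n + 1) := by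
  induction n with
  | zero =>
    refine le_antisymm (Subgroup.commutator_le.2 fun x _ y _ => ⟨commutator_scal x y, ?_⟩) ?_
    · rw [commutator_ser, zero_add, pow_one]
      exact dvd_sub ((X_dvd_one_sub_expSeries _).mul_right _)
        ((X_dvd_one_sub_expSeries _).mul_right _)
    · intro x hx
      obtain ⟨f, -, rfl⟩ := exists_eq_commutator hx
      exact Subgroup.commutator_mem_commutator (Subgroup.mem_top _) (Subgroup.mem_top _)
  | succ n ih =>
    refine le_antisymm (Subgroup.commutator_le.2 fun x hx y _ => ⟨commutator_scal x y, ?_⟩) ?_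
    · obtain ⟨h1, h2⟩ := ih.le hx
      rw [commutator_ser, h1, neg_zero, expSeries_zero, sub_self, zero_mul, sub_zero, pow_succ']
      exact mul_dvd_mul (X_dvd_one_sub_expSeries _) h2
    · intro x hx
      obtain ⟨f, hf, rfl⟩ := exists_eq_commutator hx
      exact Subgroup.commutator_mem_commutator (ih.ge ⟨rfl, hf⟩) (Subgroup.mem_top _)

theorem mem_gLCS_succ_iff {n : ℕ} {x : ExpAffine} :
    x ∈ gLCS ExpAffine (n + 1) ↔ x.scal = 0 ∧ PowerSeries.X ^ (n + 1) ∣ x.ser := by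
  rw [gLCS_succ_eq_level]
  rfl

theorem inv_mul_mem_gLCS_succ_iff {n : ℕ} {x y : ExpAffine} :
    x⁻¹ * y ∈ gLCS ExpAffine (n + 1) ↔
      x.scal = y.scal ∧ PowerSeries.X ^ (n + 1) ∣ x.ser - y.ser := by
  have h : (x⁻¹ * y).ser = -(expSeries x.scal * (x.ser - y.ser)) := by
    rw [mul_ser, inv_ser, inv_scal, neg_neg]
    ring
  rw [mem_gLCS_succ_iff, h, dvd_neg, (isUnit_expSeries _).dvd_mul_left, mul_scal, inv_scal,
    neg_add_eq_zero]

end ExpAffine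

/-- A lower central quotient that is isomorphic to a `ℚ`-vector space is a `ℚ`-vector space. -/
theorem nonempty_module_gr {Γ V : Type*} [Group Γ] [AddCommGroup V] [Module ℚ V] {n : ℕ}
    (ψ : gLCS Γ n →* Multiplicative V) (hψ : Function.Surjective ψ)
    (hker : ∀ x : gLCS Γ n, ψ x = 1 ↔ (x : Γ) ∈ gLCS Γ (n + 1)) :
    Nonempty (Module ℚ (Additive (Gr Γ n))) := by
  have h : (gLCS Γ (n + 1)).subgroupOf (gLCS Γ n) = ψ.ker := by
    ext x
    rw [Subgroup.mem_subgroupOf, MonoidHom.mem_ker, hker]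
  let e : Gr Γ n ≃* Multiplicative V :=
    (QuotientGroup.quotientMulEquivOfEq h).trans
      (QuotientGroup.quotientKerEquivOfSurjective ψ hψ)
  let e' : Additive (Gr Γ n) ≃+ V := MulEquiv.toAdditiveLeft e
  exact ⟨e'.module ℚ⟩

namespace ExpAffine

theorem nonempty_module_gr_zero : Nonempty (Module ℚ (Additive (Gr ExpAffine 0))) := by
  refine nonempty_module_gr (V := ℚ × ℚ)
    (MonoidHom.mk' (fun x => Multiplicative.ofAdd
        (PowerSeries.constantCoeff x.1.ser, x.1.scal))
      fun x y => by
        rw [← ofAdd_add, Prod.mk_add_mk, Subgroup.coe_mul, mul_ser, mul_scal, map_add, map_mul,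
          constantCoeff_expSeries, one_mul]) ?_ ?_
  · intro v
    refine ⟨⟨⟨PowerSeries.C (Multiplicative.toAdd v).1, (Multiplicative.toAdd v).2⟩,
      Subgroup.mem_top _⟩, ?_⟩
    rw [MonoidHom.mk'_apply, PowerSeries.constantCoeff_C]
    rfl
  · intro x
    refine Iff.trans Prod.ext_iff ?_
    rw [mem_gLCS_succ_iff, zero_add, pow_one, PowerSeries.X_dvd_iff, and_comm]
    rfl

theorem nonempty_module_gr_succ (n : ℕ) :
    Nonempty (Module ℚ (Additive (Gr ExpAffine (n + 1)))) := by
  refine nonempty_module_gr (V := ℚ)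
    (MonoidHom.mk' (fun x => Multiplicative.ofAdd (PowerSeries.coeff (n + 1) x.1.ser))
      fun x y => by
        rw [← ofAdd_add, Subgroup.coe_mul, mul_ser, (mem_gLCS_succ_iff.1 x.2).1, neg_zero,
          expSeries_zero, one_mul, map_add]) ?_ ?_
  · intro v
    refine ⟨⟨⟨PowerSeries.monomial (n + 1) (Multiplicative.toAdd v), 0⟩,
      mem_gLCS_succ_iff.2 ⟨rfl, ?_⟩⟩, ?_⟩
    · rw [PowerSeries.X_pow_dvd_iff]
      intro m hm
      rw [PowerSeries.coeff_monomial, if_neg hm.ne]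
    · rw [MonoidHom.mk'_apply, PowerSeries.coeff_monomial_same]
      rfl
  · intro x
    obtain ⟨h1, h2⟩ := mem_gLCS_succ_iff.1 x.2
    rw [PowerSeries.X_pow_dvd_iff] at h2
    rw [mem_gLCS_succ_iff, PowerSeries.X_pow_dvd_iff]
    refine ⟨fun h => ⟨h1, fun m hm => ?_⟩, fun h =>
      congrArg Multiplicative.ofAdd (h.2 (n + 1) (Nat.lt_succ_self _))⟩
    rcases Nat.lt_succ_iff_lt_or_eq.1 hm with h3 | rfl
    · exact h2 m h3
    · exact h

theorem bijective_toGLimit : Function.Bijective (toGLimit ExpAffine) := by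
  constructor
  · intro x y h
    have h1 : ∀ n, x⁻¹ * y ∈ gLCS ExpAffine n := fun n =>
      QuotientGroup.eq.1 (congrFun (congrArg Subtype.val h) n)
    ext n
    · have h2 := PowerSeries.X_pow_dvd_iff.1 (inv_mul_mem_gLCS_succ_iff.1 (h1 (n + 1))).2 n
        (Nat.lt_succ_self n)
      rwa [map_sub, sub_eq_zero] at h2
    · exact (inv_mul_mem_gLCS_succ_iff.1 (h1 1)).1
  · rintro ⟨F, hF⟩
    choose y hy using fun n => QuotientGroup.mk_surjective (F n)
    have h1 : ∀ m n, m ≤ n → (y n)⁻¹ * y m ∈ gLCS ExpAffine m := fun m n h =>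
      QuotientGroup.eq.1 (by rw [hy m, ← hF m n h, ← hy n]; rfl)
    -- The component of index `k + 1` determines series modulo `X ^ (k + 1)`, hence the coefficient
    -- of `X ^ k`; the exponent `scal` is already visible at index 1.
    refine ⟨⟨PowerSeries.mk fun k => PowerSeries.coeff k (y (k + 1)).ser, (y 1).scal⟩,
      Subtype.ext (funext fun n => ?_)⟩
    change QuotientGroup.mk _ = F n
    rw [← hy n]
    cases n with
    | zero => exact QuotientGroup.eq.2 (Subgroup.mem_top _)
    | succ n =>
      rw [QuotientGroup.eq, inv_mul_mem_gLCS_succ_iff, PowerSeries.X_pow_dvd_iff]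
      refine ⟨(inv_mul_mem_gLCS_succ_iff.1 (h1 1 (n + 1) (Nat.le_add_left 1 n))).1.symm,
        fun k hk => ?_⟩
      have h2 := PowerSeries.X_pow_dvd_iff.1 (inv_mul_mem_gLCS_succ_iff.1 (h1 (k + 1) (n + 1) hk)).2 k
        (Nat.lt_succ_self k)
      rw [map_sub, sub_eq_zero] at h2
      rw [map_sub, PowerSeries.coeff_mk, h2, sub_self]

theorem isMalcevGroup : IsMalcevGroup ExpAffine :=
  ⟨fun n => n.casesOn nonempty_module_gr_zero nonempty_module_gr_succ, bijective_toGLimit⟩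

end ExpAffine

end ExpAffine

/-! ### Lower central quotients of the lamplighter group. -/

section LamplighterGroup

open scoped commutatorElement PowerSeries

theorem exists_map_eq_zpow_mul_zpow {G Q : Type*} [Group G] [Group Q] (f : G →* Q) {a b g : G}
    (hc : Commute (f a) (f b)) (hg : g ∈ Subgroup.closure {a, b}) :
    ∃ i j : ℤ, f g = f a ^ i * f b ^ j := by
  induction hg using Subgroup.closure_induction with
  | mem x hx =>
    rcases hx with rfl | rfl
    · exact ⟨1, 0, by simp⟩
    · exact ⟨0, 1, by simp⟩
  | one => exact ⟨0, 0, by simp⟩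
  | mul x y _ _ hx hy =>
    obtain ⟨i, j, h⟩ := hx
    obtain ⟨k, l, h'⟩ := hy
    refine ⟨i + k, j + l, ?_⟩
    rw [map_mul, h, h', zpow_add, zpow_add, mul_assoc, mul_assoc, ← mul_assoc (f b ^ j),
      ← mul_assoc (f a ^ k), (hc.zpow_zpow k j).eq]
  | inv x _ hx =>
    obtain ⟨i, j, h⟩ := hx
    refine ⟨-i, -j, ?_⟩
    rw [map_inv, h, mul_inv_rev, ← zpow_neg, ← zpow_neg, (hc.zpow_zpow _ _).eq]

namespace LamplighterGroup

/-- The generator `a`. -/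
def a : LamplighterGroup := PresentedGroup.of 0

/-- The generator `b`. -/
def b : LamplighterGroup := PresentedGroup.of 1

theorem closure_generators : Subgroup.closure {a, b} = (⊤ : Subgroup LamplighterGroup) := by
  rw [← PresentedGroup.closure_range_of relators]
  congr 1
  ext x
  simp [Fin.exists_fin_two, a, b, eq_comm]

theorem commute_a_conj (i : ℤ) : Commute a (b ^ (-i) * a * b ^ i) := by
  rw [← commutatorElement_eq_one_iff_commute]
  exact (QuotientGroup.eq_one_iff _).2 (Subgroup.subset_normalClosure ⟨i, rfl⟩)

/-- The elements all of whose conjugates by powers of `b` commute with `a`. -/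
def lampSubgroup : Subgroup LamplighterGroup where
  carrier := {x | ∀ i : ℤ, Commute a (b ^ (-i) * x * b ^ i)}
  one_mem' i := by simp
  mul_mem' {x y} hx hy i := by
    have e : b ^ (-i) * (x * y) * b ^ i = (b ^ (-i) * x * b ^ i) * (b ^ (-i) * y * b ^ i) := by
      group
    rw [e]
    exact (hx i).mul_right (hy i)
  inv_mem' {x} hx i := by
    have e : b ^ (-i) * x⁻¹ * b ^ i = (b ^ (-i) * x * b ^ i)⁻¹ := by group
    rw [e]
    exact (hx i).inv_right

theorem a_mem_lampSubgroup : a ∈ lampSubgroup := commute_a_conj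

theorem commute_a_of_mem {x : LamplighterGroup} (hx : x ∈ lampSubgroup) : Commute x a := by
  simpa using (hx 0).symm

theorem conj_b_mem {x : LamplighterGroup} (hx : x ∈ lampSubgroup) :
    b * x * b⁻¹ ∈ lampSubgroup := fun i => by
  have e : b ^ (-i) * (b * x * b⁻¹) * b ^ i = b ^ (-(i - 1)) * x * b ^ (i - 1) := by group
  rw [e]
  exact hx (i - 1)

/-- The iterated commutators `[…[[a, b], b], …, b]`. -/
def iterComm : ℕ → LamplighterGroup
  | 0 => a
  | n + 1 => ⁅iterComm n, b⁆

/-- Bracketing with `b` multiplies by a `b`-conjugate of the inverse, and conjugation by `b` only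
shifts the index `i` in `lampSubgroup`. The purpose is that all iterated commutators commute with
`a`. -/
theorem iterComm_mem_lampSubgroup (n : ℕ) : iterComm n ∈ lampSubgroup := by
  induction n with
  | zero => exact a_mem_lampSubgroup
  | succ n ih =>
    have e : iterComm (n + 1) = iterComm n * (b * (iterComm n)⁻¹ * b⁻¹) := by
      simp [iterComm, commutatorElement_def, mul_assoc]
    rw [e]
    exact mul_mem ih (conj_b_mem (inv_mem ih))

theorem iterComm_mem_gLCS (n : ℕ) : iterComm n ∈ gLCS LamplighterGroup n := by
  induction n with
  | zero => exact Subgroup.mem_top _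
  | succ n ih => exact Subgroup.commutator_mem_commutator ih (Subgroup.mem_top _)

/-- Bracketing `iterComm (n + 1)` with `a` gives 1 and with `b` gives `iterComm (n + 2)`, so one
generator of a quotient yields one generator of the next. -/
theorem gLCS_le_zpowers_sup (n : ℕ) : gLCS LamplighterGroup (n + 1) ≤
    Subgroup.zpowers (iterComm (n + 1)) ⊔ gLCS LamplighterGroup (n + 2) := by
  have hK : ∀ n : ℕ, (Subgroup.zpowers (iterComm (n + 1)) ⊔
      gLCS LamplighterGroup (n + 2)).Normal := fun n =>
    normal_of_gLCS_le le_sup_right (sup_le ((Subgroup.zpowers_le).2 (iterComm_mem_gLCS _))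
      (gLCS_antitone _ (Nat.le_succ _)))
  induction n with
  | zero =>
    have := hK 0
    have h1 : ⁅a, b⁆ ∈ Subgroup.zpowers (iterComm (0 + 1)) ⊔ gLCS LamplighterGroup (0 + 2) :=
      (le_sup_left : Subgroup.zpowers _ ≤ _) (Subgroup.mem_zpowers _)
    refine commutator_top_le_of_closure closure_generators fun z _ s hs => ?_
    rw [← mem_centralizerMod']
    -- With the generator `s` fixed, the other entry may also be taken among the generators, leaving
    -- only the commutators of `a` and `b`.
    suffices h : Subgroup.closure {a, b} ≤ centralizerMod
        (Subgroup.zpowers (iterComm (0 + 1)) ⊔ gLCS LamplighterGroup (0 + 2)) s by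
      rw [closure_generators] at h
      exact h (Subgroup.mem_top z)
    rw [Subgroup.closure_le]
    rintro r (rfl | rfl) <;> rcases hs with rfl | rfl
    · exact mem_centralizerMod.2 (by rw [commutatorElement_self]; exact one_mem _)
    · exact mem_centralizerMod'.2 h1
    · exact mem_centralizerMod.2 h1
    · exact mem_centralizerMod.2 (by rw [commutatorElement_self]; exact one_mem _)
  | succ n ih =>
    have := hK (n + 1)
    refine commutator_top_le_of_closure closure_generators fun z hz s hs => ?_
    rw [← mem_centralizerMod']
    refine (ih.trans (sup_le (Subgroup.zpowers_le.2 ?_) fun r hr => ?_)) hz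
    · rw [mem_centralizerMod']
      rcases hs with rfl | rfl
      · rw [commutatorElement_eq_one_iff_commute.2 (commute_a_of_mem (iterComm_mem_lampSubgroup _))]
        exact one_mem _
      · exact (le_sup_left : Subgroup.zpowers _ ≤ _) (Subgroup.mem_zpowers _)
    · rw [mem_centralizerMod']
      exact (le_sup_right : gLCS LamplighterGroup (n + 3) ≤ _)
        (Subgroup.commutator_mem_commutator hr (Subgroup.mem_top s))

theorem exists_eq_zpow_mul {n : ℕ} {g : LamplighterGroup}
    (hg : g ∈ gLCS LamplighterGroup (n + 1)) :
    ∃ k : ℤ, ∃ r ∈ gLCS LamplighterGroup (n + 2), g = iterComm (n + 1) ^ k * r := by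
  obtain ⟨_, ⟨k, rfl⟩, r, hr, e⟩ := Subgroup.mem_sup_of_normal_right.1 (gLCS_le_zpowers_sup n hg)
  exact ⟨k, r, hr, e.symm⟩

theorem exists_eq_zpow_mul_zpow_mul (g : LamplighterGroup) :
    ∃ i j : ℤ, ∃ r ∈ gLCS LamplighterGroup 1, g = a ^ i * b ^ j * r := by
  suffices ∃ i j : ℤ, (a ^ i * b ^ j)⁻¹ * g ∈ gLCS LamplighterGroup 1 by
    obtain ⟨i, j, h⟩ := this
    exact ⟨i, j, _, h, by group⟩
  have hg : g ∈ Subgroup.closure {a, b} := by rw [closure_generators]; trivial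
  obtain ⟨i, j, h⟩ := exists_map_eq_zpow_mul_zpow
    (QuotientGroup.mk' (gLCS LamplighterGroup 1))
    (commute_mk_of_mem_gLCS (n := 0) (Subgroup.mem_top a) b) hg
  rw [← map_zpow, ← map_zpow, ← map_mul] at h
  exact ⟨i, j, QuotientGroup.eq.1 h.symm⟩

end LamplighterGroup

end LamplighterGroup

/-! ### The lamplighter group in the matrix group. -/

section ConcreteCompletion

open scoped commutatorElement PowerSeries

namespace ExpAffine

/-- The inclusion `f ↦ ⟨f, 0⟩`. -/
noncomputable def inl : Multiplicative ℚ⟦X⟧ →* ExpAffine where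
  toFun f := ⟨Multiplicative.toAdd f, 0⟩
  map_one' := rfl
  map_mul' f g := by ext1 <;> simp [expSeries_zero]

/-- The inclusion `c ↦ ⟨0, c⟩`. -/
noncomputable def inr : Multiplicative ℚ →* ExpAffine where
  toFun c := ⟨0, Multiplicative.toAdd c⟩
  map_one' := rfl
  map_mul' c d := by ext1 <;> simp

theorem mk_zero_zpow (f : ℚ⟦X⟧) (k : ℤ) : (⟨f, 0⟩ : ExpAffine) ^ k = ⟨k • f, 0⟩ :=
  (map_zpow inl (Multiplicative.ofAdd f) k).symm

theorem zero_mk_zpow (c : ℚ) (k : ℤ) : (⟨0, c⟩ : ExpAffine) ^ k = ⟨0, k * c⟩ := by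
  refine (map_zpow inr (Multiplicative.ofAdd c) k).symm.trans ?_
  ext1
  · rfl
  · exact zsmul_eq_mul c k

theorem pow_scal (x : ExpAffine) (k : ℕ) : (x ^ k).scal = k * x.scal := by
  induction k with
  | zero => simp
  | succ k ih => rw [pow_succ, mul_scal, ih]; push_cast; ring

theorem constantCoeff_pow_ser (x : ExpAffine) (k : ℕ) :
    PowerSeries.constantCoeff (x ^ k).ser = k * PowerSeries.constantCoeff x.ser := by
  induction k with
  | zero => simp
  | succ k ih =>
    rw [pow_succ, mul_ser, map_add, map_mul, constantCoeff_expSeries, ih]; push_cast; ring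

end ExpAffine

namespace LamplighterGroup

/-- The embedding of the lamplighter group that sends `a` to `⟨1, 0⟩` and `b` to `⟨0, 1⟩`. -/
noncomputable def toExpAffine : LamplighterGroup →* ExpAffine :=
  PresentedGroup.toGroup (f := ![⟨1, 0⟩, ⟨0, 1⟩]) (by
    rintro _ ⟨i, rfl⟩
    -- Conjugates of `a` have `scal = 0`, and elements with `scal = 0` commute with each other.
    have h : ∀ x y : ExpAffine, x.scal = 0 → y.scal = 0 → ⁅x, y⁆ = 1 := fun x y hx hy => by
      ext1
      · rw [ExpAffine.commutator_ser, hx, hy, neg_zero, expSeries_zero]; simp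
      · rw [ExpAffine.commutator_scal]; rfl
    rw [map_commutatorElement]
    apply h
    · simp
    · simp only [map_mul, map_zpow, FreeGroup.lift_apply_of, Matrix.cons_val_zero,
        Matrix.cons_val_one, ExpAffine.zero_mk_zpow, ExpAffine.mul_scal]
      push_cast
      ring)

theorem toExpAffine_a : toExpAffine a = ⟨1, 0⟩ := by
  simp [toExpAffine, a]

theorem toExpAffine_b : toExpAffine b = ⟨0, 1⟩ := by
  simp [toExpAffine, b]

/-- Each bracket with `b` contributes a factor 1 - e^{-X} = X · `expQuot (-1)`. The leading
coefficient 1 places the cyclic quotients of the lamplighter group as ℤ inside ℚ. -/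
theorem toExpAffine_iterComm (n : ℕ) : ∃ f : ℚ⟦X⟧, toExpAffine (iterComm n) = ⟨f, 0⟩ ∧
    PowerSeries.X ^ n ∣ f ∧ PowerSeries.coeff n f = 1 := by
  suffices h : toExpAffine (iterComm n) = ⟨PowerSeries.X ^ n * expQuot (-1) ^ n, 0⟩ by
    refine ⟨_, h, dvd_mul_right _ _, ?_⟩
    rw [PowerSeries.coeff_X_pow_mul', if_pos le_rfl, Nat.sub_self,
      PowerSeries.coeff_zero_eq_constantCoeff_apply, map_pow, constantCoeff_expQuot, one_pow]
  induction n with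
  | zero => simp [iterComm, toExpAffine_a]
  | succ n ih =>
    rw [iterComm, map_commutatorElement, ih, toExpAffine_b]
    ext1
    · have h1 := C_mul_X_mul_expQuot (-1)
      rw [map_neg, map_one] at h1
      rw [ExpAffine.commutator_ser]
      linear_combination PowerSeries.X ^ n * expQuot (-1) ^ n * h1
    · rw [ExpAffine.commutator_scal]

theorem isRationalGrIso_toExpAffine : IsRationalGrIso toExpAffine := by
  rintro (_ | n)
  · constructor
    · intro g _ hg
      obtain ⟨i, j, r, hr, rfl⟩ := exists_eq_zpow_mul_zpow_mul g
      have h1 := map_gLCS_le toExpAffine 1 (Subgroup.mem_map_of_mem _ hr)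
      rw [map_mul, Subgroup.mul_mem_cancel_right _ h1, map_mul, map_zpow, map_zpow,
        toExpAffine_a, toExpAffine_b, ExpAffine.mk_zero_zpow, ExpAffine.zero_mk_zpow,
        ExpAffine.mem_gLCS_succ_iff] at hg
      obtain ⟨h2, h3⟩ := hg
      rw [zero_add, pow_one, PowerSeries.X_dvd_iff] at h3
      simp at h2 h3
      refine ⟨1, one_pos, ?_⟩
      rw [h2, h3]
      simpa using hr
    · intro x _
      set p := PowerSeries.constantCoeff x.ser with hp
      -- The product of the two denominators makes both coordinates of the abelianization integral
      -- at once.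
      refine ⟨p.den * x.scal.den, Nat.mul_pos p.den_pos x.scal.den_pos,
        a ^ (p.num * x.scal.den) * b ^ (x.scal.num * p.den), Subgroup.mem_top _, ?_⟩
      have e1 := Rat.mul_den_eq_num p
      have e2 := Rat.mul_den_eq_num x.scal
      rw [map_mul, map_zpow, map_zpow, toExpAffine_a, toExpAffine_b, ExpAffine.mk_zero_zpow,
        ExpAffine.zero_mk_zpow, ExpAffine.inv_mul_mem_gLCS_succ_iff, zero_add, pow_one,
        PowerSeries.X_dvd_iff, map_sub, ExpAffine.constantCoeff_pow_ser, ExpAffine.pow_scal,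
        ExpAffine.mul_scal, ExpAffine.mul_ser, ← hp]
      constructor
      · push_cast
        rw [← e2]
        ring
      · simp
        rw [← e1]
        ring
  · constructor
    · intro g hg hη
      obtain ⟨k, r, hr, rfl⟩ := exists_eq_zpow_mul hg
      obtain ⟨f, hf, h1, h2⟩ := toExpAffine_iterComm (n + 1)
      have h3 := map_gLCS_le toExpAffine (n + 2) (Subgroup.mem_map_of_mem _ hr)
      rw [map_mul, Subgroup.mul_mem_cancel_right _ h3, map_zpow, hf, ExpAffine.mk_zero_zpow,
        ExpAffine.mem_gLCS_succ_iff] at hη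
      have h4 := PowerSeries.X_pow_dvd_iff.1 hη.2 (n + 1) (Nat.lt_succ_self _)
      rw [map_zsmul, h2] at h4
      have h5 : k = 0 := by simpa using h4
      refine ⟨1, one_pos, ?_⟩
      rw [h5]
      simpa using hr
    · intro x hx
      obtain ⟨h1, h2⟩ := ExpAffine.mem_gLCS_succ_iff.1 hx
      obtain ⟨s, c⟩ := x
      obtain rfl : c = 0 := h1
      obtain ⟨f, hf, h3, h4⟩ := toExpAffine_iterComm (n + 1)
      set p := PowerSeries.coeff (n + 1) s with hp
      have e1 := Rat.mul_den_eq_num p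
      refine ⟨p.den, p.den_pos, iterComm (n + 1) ^ p.num, zpow_mem (iterComm_mem_gLCS _) _, ?_⟩
      rw [map_zpow, hf, ExpAffine.mk_zero_zpow, ← zpow_natCast, ExpAffine.mk_zero_zpow,
        ExpAffine.inv_mul_mem_gLCS_succ_iff]
      refine ⟨rfl, PowerSeries.X_pow_dvd_iff.2 fun m hm => ?_⟩
      rw [map_sub, map_zsmul, map_zsmul]
      rcases Nat.lt_succ_iff_lt_or_eq.1 hm with h5 | rfl
      · rw [PowerSeries.X_pow_dvd_iff.1 h3 m h5, PowerSeries.X_pow_dvd_iff.1 h2 m h5]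
        simp
      · rw [h4, ← hp, zsmul_eq_mul, zsmul_eq_mul, ← e1]
        push_cast
        ring

theorem isMalcevCompletion_toExpAffine : IsMalcevCompletion toExpAffine :=
  ExpAffine.isMalcevGroup.isMalcevCompletion isRationalGrIso_toExpAffine

end LamplighterGroup

end ConcreteCompletion

/-! ### Dynkin's index sums as coefficients of power series. -/

section DynkinSums

open scoped PowerSeries

theorem mem_dynkinIndex {d k : ℕ} {rs : Fin k → ℕ × ℕ} : rs ∈ dynkinIndex d k ↔
    (∀ i, 0 < (rs i).1 + (rs i).2) ∧ ∑ i, ((rs i).1 + (rs i).2) = d := by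
  rw [dynkinIndex, Finset.mem_filter, and_iff_right_iff_imp]
  rintro ⟨-, h⟩
  rw [Fintype.mem_piFinset]
  intro i
  have := Finset.single_le_sum (f := fun i => (rs i).1 + (rs i).2) (fun i _ => Nat.zero_le _)
    (Finset.mem_univ i)
  simp only [h] at this
  rw [Finset.mem_product, Finset.mem_range, Finset.mem_range]
  omega

/-- The sums over `dynkinIndex d k` are the coefficients of the `k`-th power of a power series. -/
theorem sum_dynkinIndex_prod {R : Type*} [Ring R] (g : ℕ × ℕ → R) (k d : ℕ) :
    ∑ rs ∈ dynkinIndex d k, (List.ofFn fun i => g (rs i)).prod =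
      PowerSeries.coeff d ((PowerSeries.mk fun n =>
        ∑ p ∈ (Finset.HasAntidiagonal.antidiagonal n).filter (fun p => 0 < p.1 + p.2), g p) ^ k) := by
  induction k generalizing d with
  | zero =>
    rw [pow_zero, PowerSeries.coeff_one]
    split_ifs with h
    · subst h
      have : dynkinIndex 0 0 = {Fin.elim0} := by
        ext rs
        rw [mem_dynkinIndex]
        simpa using Subsingleton.elim _ _
      rw [this]
      simp
    · have : dynkinIndex d 0 = ∅ := by
        ext rs
        rw [mem_dynkinIndex]
        simpa using fun h' => h h'.symm
      rw [this]
      simp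
  | succ k ih =>
    rw [pow_succ', PowerSeries.coeff_mul]
    simp only [PowerSeries.coeff_mk, ← ih, Finset.sum_mul_sum, ← Finset.sum_product']
    rw [Finset.sum_sigma']
    -- The first pair is split off; the outer index records how the degree divides between it and
    -- the remaining `k` pairs.
    refine Finset.sum_bij' (fun rs _ => ⟨((rs 0).1 + (rs 0).2,
      ∑ i : Fin k, ((rs i.succ).1 + (rs i.succ).2)), (rs 0, Fin.tail rs)⟩)
      (fun q _ => Fin.cons q.2.1 q.2.2) ?_ ?_ ?_ ?_ ?_
    · intro rs h
      obtain ⟨h1, h2⟩ := mem_dynkinIndex.1 h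
      rw [Fin.sum_univ_succ] at h2
      simp only [Finset.mem_sigma, Finset.HasAntidiagonal.mem_antidiagonal,
        Finset.mem_product, Finset.mem_filter, mem_dynkinIndex]
      exact ⟨h2, ⟨trivial, h1 0⟩, fun i => h1 i.succ, rfl⟩
    · rintro ⟨⟨i, j⟩, ⟨p, rs⟩⟩ h
      simp only [Finset.mem_sigma, Finset.HasAntidiagonal.mem_antidiagonal,
        Finset.mem_product, Finset.mem_filter, mem_dynkinIndex] at h
      obtain ⟨h1, ⟨h2, h3⟩, h4, h5⟩ := h
      rw [mem_dynkinIndex, Fin.sum_univ_succ]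
      refine ⟨fun i => ?_, ?_⟩
      · refine Fin.cases ?_ (fun i => ?_) i
        · simpa using h3
        · simpa using h4 i
      · simp only [Fin.cons_zero, Fin.cons_succ]
        rw [h2, h5, h1]
    · intro rs _
      exact Fin.cons_self_tail rs
    · rintro ⟨⟨i, j⟩, ⟨p, rs⟩⟩ h
      simp only [Finset.mem_sigma, Finset.HasAntidiagonal.mem_antidiagonal,
        Finset.mem_product, Finset.mem_filter, mem_dynkinIndex] at h
      obtain ⟨h1, ⟨h2, h3⟩, h4, h5⟩ := h
      subst h2 h5
      simp
    · intro rs _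
      rw [List.ofFn_succ, List.prod_cons]
      rfl

theorem prod_dynkinWord {R : Type*} [Monoid R] (x y : R) {k : ℕ} (rs : Fin k → ℕ × ℕ) :
    (dynkinWord x y rs).prod = (List.ofFn fun i => x ^ (rs i).1 * y ^ (rs i).2).prod := by
  rw [dynkinWord, List.flatMap_def, List.prod_flatten, List.map_map, List.map_ofFn]
  congr 2
  funext i
  simp

/-- The power series `e^{TX}`. -/
noncomputable def expSeriesOf {R : Type*} [Ring R] [Algebra ℚ R] (T : R) : R⟦X⟧ :=
  PowerSeries.mk fun n => (n ! : ℚ)⁻¹ • T ^ n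

/-- The requirement `rᵢ + sᵢ > 0` removes the constant term of the product of exponentials, whence
the `- 1`. -/
theorem sum_dynkinIndex_smul_prod {R : Type*} [Ring R] [Algebra ℚ R] (x y : R) (k d : ℕ) :
    ∑ rs ∈ dynkinIndex d k, (∏ i, (((rs i).1 ! : ℚ) * ((rs i).2 ! : ℚ)))⁻¹ •
      (dynkinWord x y rs).prod =
    PowerSeries.coeff d ((expSeriesOf x * expSeriesOf y - 1) ^ k) := by
  have h1 : expSeriesOf x * expSeriesOf y - 1 = PowerSeries.mk fun n =>
      ∑ p ∈ (Finset.HasAntidiagonal.antidiagonal n).filter (fun p => 0 < p.1 + p.2),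
        ((p.1 ! : ℚ) * (p.2 ! : ℚ))⁻¹ • (x ^ p.1 * y ^ p.2) := by
    ext n
    rw [map_sub, PowerSeries.coeff_mul, PowerSeries.coeff_one, PowerSeries.coeff_mk]
    cases n with
    | zero => simp [expSeriesOf, Finset.filter_singleton]
    | succ n =>
      rw [if_neg (Nat.succ_ne_zero n), sub_zero, Finset.filter_true_of_mem]
      · refine Finset.sum_congr rfl fun p _ => ?_
        rw [expSeriesOf, expSeriesOf, PowerSeries.coeff_mk, PowerSeries.coeff_mk,
          smul_mul_smul_comm, mul_inv]
      · intro p hp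
        rw [Finset.HasAntidiagonal.mem_antidiagonal.1 hp]
        exact Nat.succ_pos n
  rw [h1, ← sum_dynkinIndex_prod]
  refine Finset.sum_congr rfl fun rs hrs => ?_
  rw [prod_dynkinWord]
  clear h1 hrs
  induction k with
  | zero => simp
  | succ k ih =>
    rw [List.ofFn_succ, List.ofFn_succ, List.prod_cons, List.prod_cons, Fin.prod_univ_succ,
      ← ih fun i => rs i.succ, smul_mul_smul_comm, mul_inv]

end DynkinSums

/-! ### Truncated logarithm and the expected series ζ. -/

section LogarithmSeries

open scoped PowerSeries

theorem expQuot_eq_rescale (c : ℚ) : expQuot c = PowerSeries.rescale c (expQuot 1) := by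
  ext n
  rw [PowerSeries.coeff_rescale, expQuot, expQuot, PowerSeries.coeff_mk, PowerSeries.coeff_mk]
  simp [div_eq_mul_inv]

theorem expSeries_eq_rescale (c : ℚ) : expSeries c = PowerSeries.rescale c (expSeries 1) := by
  rw [expSeries, expSeries, PowerSeries.rescale_rescale, one_mul]

theorem derivative_expSeries (c : ℚ) :
    PowerSeries.derivative ℚ (expSeries c) = PowerSeries.C c * expSeries c := by
  ext n
  rw [PowerSeries.coeff_derivative, PowerSeries.coeff_C_mul, coeff_expSeries, coeff_expSeries,
    Nat.factorial_succ]
  push_cast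
  field_simp
  ring

theorem X_mul_derivative_expQuot (c : ℚ) :
    PowerSeries.X * PowerSeries.derivative ℚ (expQuot c) = expSeries c - expQuot c := by
  ext n
  rw [map_sub, coeff_expSeries]
  cases n with
  | zero => simp [expQuot]
  | succ n =>
    rw [PowerSeries.coeff_succ_X_mul, PowerSeries.coeff_derivative, expQuot, PowerSeries.coeff_mk,
      Nat.factorial_succ (n + 1)]
    push_cast
    field_simp
    ring

/-- The logarithm series inverts the exponential series, up to degree `d`. -/
theorem exists_sum_log_mul_expQuot (c : ℚ) (d : ℕ) : ∃ h : ℚ⟦X⟧,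
    (∑ k ∈ Finset.range d, PowerSeries.C ((-1 : ℚ) ^ k / (k + 1)) * (expSeries c - 1) ^ k) *
      expQuot c = 1 + PowerSeries.X ^ d * h := by
  -- Rescaling X reduces to `c = 1`; the value `c = 0` is covered because nothing is divided by `c`.
  suffices H : ∃ h : ℚ⟦X⟧,
      (∑ k ∈ Finset.range d, PowerSeries.C ((-1 : ℚ) ^ k / (k + 1)) * (expSeries 1 - 1) ^ k) *
        expQuot 1 = 1 + PowerSeries.X ^ d * h by
    obtain ⟨h, hh⟩ := H
    refine ⟨PowerSeries.C c ^ d * PowerSeries.rescale c h, ?_⟩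
    have h1 := congrArg (PowerSeries.rescale c) hh
    have hC : ∀ r : ℚ, PowerSeries.rescale c (PowerSeries.C r) = PowerSeries.C r := fun r => by
      ext n
      rw [PowerSeries.coeff_rescale, PowerSeries.coeff_C]
      split_ifs with h
      · simp [h]
      · simp
    simp only [map_mul, map_sum, map_pow, map_sub, map_add, map_one, hC, PowerSeries.rescale_X,
      ← expSeries_eq_rescale, ← expQuot_eq_rescale] at h1
    rw [h1, mul_pow]
    ring
  set W : ℚ⟦X⟧ := expSeries 1 - 1 with hW
  have hWX : PowerSeries.X * expQuot 1 = W := by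
    have := C_mul_X_mul_expQuot 1
    rwa [map_one, one_mul] at this
  set S : ℚ⟦X⟧ := ∑ k ∈ Finset.range d, PowerSeries.C ((-1 : ℚ) ^ k / (k + 1)) * W ^ k with hS
  -- Since W' = 1 + W, the derivative of the truncated log(1 + W) is a geometric sum times 1 + W,
  -- that is 1 - (-W)^d.
  have hder : PowerSeries.derivative ℚ (S * W - PowerSeries.X) = -(-W) ^ d := by
    have h1 : PowerSeries.derivative ℚ W = 1 + W := by
      rw [hW, map_sub, derivative_expSeries, PowerSeries.derivative_one]
      simp
    have h2 : PowerSeries.derivative ℚ (S * W) = ∑ k ∈ Finset.range d, (-W) ^ k * (1 + W) := by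
      rw [hS, Finset.sum_mul, map_sum]
      refine Finset.sum_congr rfl fun k _ => ?_
      rw [mul_assoc, ← pow_succ, Derivation.leibniz, PowerSeries.derivative_C, smul_zero,
        add_zero, PowerSeries.derivative_pow, h1, smul_eq_mul, neg_pow W, Nat.add_sub_cancel]
      have h3 : PowerSeries.C ((-1 : ℚ) ^ k / (k + 1)) * ((k + 1 : ℕ) : ℚ⟦X⟧) = (-1) ^ k := by
        have h4 : ((k + 1 : ℕ) : ℚ⟦X⟧) = PowerSeries.C ((k : ℚ) + 1) := by simp
        rw [h4, ← map_mul, div_mul_cancel₀ _ (by positivity)]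
        simp
      rw [← h3]
      ring
    have h3 := geom_sum_mul_neg (-W) d
    rw [sub_neg_eq_add] at h3
    rw [map_sub, h2, ← Finset.sum_mul, h3, PowerSeries.derivative_X]
    ring
  have hdvd : PowerSeries.X ^ (d + 1) ∣ S * W - PowerSeries.X := by
    rw [PowerSeries.X_pow_dvd_iff]
    intro m hm
    cases m with
    | zero => rw [← hWX]; simp
    | succ m =>
      have h1 := congrArg (PowerSeries.coeff m) hder
      rw [PowerSeries.coeff_derivative] at h1
      have h2 : PowerSeries.X ^ d ∣ -(-W) ^ d := by
        rw [dvd_neg, ← hWX]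
        exact pow_dvd_pow_of_dvd (dvd_neg.2 (dvd_mul_right _ _)) d
      rw [PowerSeries.X_pow_dvd_iff.1 h2 m (Nat.lt_of_succ_lt_succ hm)] at h1
      exact (mul_eq_zero.1 h1).resolve_right (by positivity)
  obtain ⟨h, hh⟩ := hdvd
  refine ⟨h, mul_left_cancel₀ PowerSeries.X_ne_zero ?_⟩
  linear_combination hh + S * hWX

/-- The power series `ζ` with `ζ(X) = log (exp (xX) exp (yX))` in the upper right corner, for
`x = !![-c, p; 0, 0]` and `y = !![-d, q; 0, 0]`. -/
noncomputable def bchSeries (p c q d : ℚ) : ℚ⟦X⟧ :=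
  PowerSeries.X * (PowerSeries.C p * expQuot (-c) +
    PowerSeries.C q * (expSeries (-c) * expQuot (-d))) * (expQuot (-(c + d)))⁻¹

theorem bchSeries_mul_expQuot (p c q d : ℚ) : bchSeries p c q d * expQuot (-(c + d)) =
    PowerSeries.X * (PowerSeries.C p * expQuot (-c) +
      PowerSeries.C q * (expSeries (-c) * expQuot (-d))) := by
  rw [bchSeries, mul_assoc, PowerSeries.inv_mul_cancel, mul_one]
  rw [constantCoeff_expQuot]
  exact one_ne_zero

/-- The right side is the corner entry of exp(x)exp(y) - 1 for letter matrices, minus ζ. Applying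
the Euler operator X d/dX to `bchSeries_mul_expQuot` and eliminating the derivatives of the
quotients gives the identity. -/
theorem expQuot_mul_derivative_bchSeries (p c q d : ℚ) :
    (PowerSeries.X * PowerSeries.derivative ℚ (bchSeries p c q d) - bchSeries p c q d) *
      expQuot (-(c + d)) =
    PowerSeries.C p * PowerSeries.X + expSeries (-c) * (PowerSeries.C q * PowerSeries.X) +
      PowerSeries.C p * PowerSeries.X * expQuot (-c) * (PowerSeries.C d * PowerSeries.X) -
      bchSeries p c q d := by
  have h1 := bchSeries_mul_expQuot p c q d
  have h2 := congrArg (PowerSeries.derivative ℚ) h1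
  simp only [Derivation.leibniz, map_add, PowerSeries.derivative_C, PowerSeries.derivative_X,
    smul_eq_mul, derivative_expSeries] at h2
  have e1 := X_mul_derivative_expQuot (-c)
  have e2 := X_mul_derivative_expQuot (-d)
  have e3 := X_mul_derivative_expQuot (-(c + d))
  have f1 := C_mul_X_mul_expQuot (-c)
  have f2 := C_mul_X_mul_expQuot (-d)
  have f3 := C_mul_X_mul_expQuot (-(c + d))
  simp only [map_neg, map_add] at h2 e1 e2 e3 f1 f2 f3
  linear_combination PowerSeries.X * h2 - bchSeries p c q d * e3 + bchSeries p c q d * f3 +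
    (PowerSeries.C c + PowerSeries.C d) * PowerSeries.X * h1 +
    PowerSeries.X * PowerSeries.C p * (e1 - f1) +
    PowerSeries.X * PowerSeries.C q * expSeries (-c) * (e2 - f2)

end LogarithmSeries

/-! ### Right-normed brackets as matrix products: the logarithm of the letter matrices. -/

section LetterMatrices

open scoped PowerSeries

/-- A power series of matrices as a matrix of power series. -/
noncomputable def seriesEntries {n : Type*} [Fintype n] [DecidableEq n] :
    (Matrix n n ℚ)⟦X⟧ →+* Matrix n n ℚ⟦X⟧ where
  toFun f := Matrix.of fun i j => PowerSeries.mk fun m => PowerSeries.coeff m f i j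
  map_zero' := by ext; simp
  map_one' := by
    ext i j m
    rw [Matrix.of_apply, PowerSeries.coeff_mk, PowerSeries.coeff_one, Matrix.one_apply]
    by_cases h1 : m = 0 <;> by_cases h2 : i = j <;>
      simp [h1, h2, PowerSeries.coeff_one, Matrix.one_apply]
  map_add' f g := by ext; simp
  map_mul' f g := by
    ext i j m
    simp only [Matrix.of_apply, PowerSeries.coeff_mk, Matrix.mul_apply, map_sum,
      PowerSeries.coeff_mul, Matrix.sum_apply]
    exact Finset.sum_comm

theorem coeff_seriesEntries {n : Type*} [Fintype n] [DecidableEq n] (f : (Matrix n n ℚ)⟦X⟧)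
    (m : ℕ) (i j : n) :
    PowerSeries.coeff m (seriesEntries f i j) = PowerSeries.coeff m f i j := by
  change PowerSeries.coeff m (PowerSeries.mk fun m => PowerSeries.coeff m f i j) = _
  rw [PowerSeries.coeff_mk]

/-- The matrix of left bracketing with `p + c t`, acting on the column of the abelian part, the
`t`-part, and a formal grading element `E` with `[p + c t, E] = p + c t`. -/
def letterMat (p c : ℚ) : Matrix (Fin 3) (Fin 3) ℚ := !![-c, p, p; 0, 0, c; 0, 0, 0]

/-- The third column vanishes from the square on because [z, [z, E]] = [z, z] = 0. -/
theorem letterMat_pow_add_two (p c : ℚ) (n : ℕ) : letterMat p c ^ (n + 2) =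
    !![(-c) ^ (n + 2), (-c) ^ (n + 1) * p, 0; 0, 0, 0; 0, 0, 0] := by
  induction n with
  | zero =>
    rw [zero_add, pow_two, letterMat]
    ext i j
    fin_cases i <;> fin_cases j <;> simp [Matrix.mul_apply, Fin.sum_univ_three] <;> ring
  | succ n ih =>
    rw [pow_succ, ih, letterMat]
    ext i j
    fin_cases i <;> fin_cases j <;> simp [Matrix.mul_apply, Fin.sum_univ_three] <;> ring

theorem seriesEntries_expSeriesOf_letterMat (p c : ℚ) :
    seriesEntries (expSeriesOf (letterMat p c)) =
      !![expSeries (-c), PowerSeries.C p * PowerSeries.X * expQuot (-c),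
          PowerSeries.C p * PowerSeries.X;
        0, 1, PowerSeries.C c * PowerSeries.X; 0, 0, 1] := by
  have h0 : ∀ n : ℕ, PowerSeries.coeff n (1 : ℚ⟦X⟧) = if n = 0 then 1 else 0 :=
    PowerSeries.coeff_one
  ext i j n
  rw [coeff_seriesEntries, expSeriesOf, PowerSeries.coeff_mk]
  rcases n with _ | _ | n
  · fin_cases i <;> fin_cases j <;> simp [coeff_expSeries]
  · fin_cases i <;> fin_cases j <;>
      simp [coeff_expSeries, letterMat, mul_assoc, PowerSeries.coeff_succ_X_mul, expQuot, h0]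
  · rw [letterMat_pow_add_two]
    fin_cases i <;> fin_cases j <;>
      simp [coeff_expSeries, mul_assoc, PowerSeries.coeff_succ_X_mul, expQuot, h0] <;> ring

theorem mat_pow_add_two {R : Type*} [CommRing R] (w b u v : R) (k : ℕ) :
    (!![w, b, u; 0, 0, v; 0, 0, 0] : Matrix (Fin 3) (Fin 3) R) ^ (k + 2) =
      !![w ^ (k + 2), w ^ (k + 1) * b, w ^ (k + 1) * u + w ^ k * b * v; 0, 0, 0; 0, 0, 0] := by
  induction k with
  | zero =>
    rw [zero_add, pow_two]
    ext i j
    fin_cases i <;> fin_cases j <;> simp [Matrix.mul_apply, Fin.sum_univ_three]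
    ring
  | succ k ih =>
    rw [pow_succ', ih]
    ext i j
    fin_cases i <;> fin_cases j <;> simp [Matrix.mul_apply, Fin.sum_univ_three] <;> ring

/-- The expression `bchTerm d x y` with products in place of right-normed brackets. -/
noncomputable def dynkinSum {R : Type*} [Ring R] [Algebra ℚ R] (d : ℕ) (x y : R) : R :=
  ∑ k ∈ Finset.Icc 1 d, ∑ rs ∈ dynkinIndex d k,
    ((-1 : ℚ) ^ (k - 1) / (k * d * ∏ i, (((rs i).1 ! : ℚ) * ((rs i).2 ! : ℚ)))) •
      (dynkinWord x y rs).prod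

theorem dynkinSum_eq {R : Type*} [Ring R] [Algebra ℚ R] (d : ℕ) (x y : R) :
    dynkinSum d x y = (d : ℚ)⁻¹ • ∑ k ∈ Finset.range d, ((-1 : ℚ) ^ k / (k + 1)) •
      PowerSeries.coeff d ((expSeriesOf x * expSeriesOf y - 1) ^ (k + 1)) := by
  rw [dynkinSum, Finset.smul_sum]
  refine Finset.sum_bij' (fun k _ => k - 1) (fun k _ => k + 1) ?_ ?_ ?_ ?_ ?_
  · intro k hk
    rw [Finset.mem_Icc] at hk
    rw [Finset.mem_range]
    omega
  · intro k hk
    rw [Finset.mem_range] at hk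
    rw [Finset.mem_Icc]
    omega
  · intro k hk
    exact Nat.sub_add_cancel (Finset.mem_Icc.1 hk).1
  · intro k _
    exact Nat.add_sub_cancel k 1
  · intro k hk
    obtain ⟨k, rfl⟩ := Nat.exists_eq_add_of_le' (Finset.mem_Icc.1 hk).1
    rw [Nat.add_sub_cancel, ← sum_dynkinIndex_smul_prod, Finset.smul_sum, Finset.smul_sum]
    refine Finset.sum_congr rfl fun rs _ => ?_
    rw [smul_smul, smul_smul]
    congr 1
    push_cast
    rw [div_eq_mul_inv, div_eq_mul_inv, mul_inv, mul_inv]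
    ring

/-- The corner entry of K^{k+1} is W^k times a fixed series, with the extra term ζ when k = 0, so
the matrix logarithm reduces to the one-variable logarithm of `exists_sum_log_mul_expQuot`. The
outcome is Xζ' up to degree n; its n-th coefficient is n times that of ζ, and Dynkin's factor 1/n
cancels the n. -/
theorem dynkinSum_letterMat (p c q d : ℚ) {n : ℕ} (hn : 0 < n) :
    dynkinSum n (letterMat p c) (letterMat q d) 0 2 = PowerSeries.coeff n (bchSeries p c q d) ∧
    dynkinSum n (letterMat p c) (letterMat q d) 1 2 = if n = 1 then c + d else 0 := by
  set K := expSeriesOf (letterMat p c) * expSeriesOf (letterMat q d) - 1 with hK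
  set W : ℚ⟦X⟧ := expSeries (-(c + d)) - 1 with hW
  set ζ := bchSeries p c q d with hζ
  have hentries : seriesEntries K = !![W, ζ * expQuot (-(c + d)),
      PowerSeries.C p * PowerSeries.X + expSeries (-c) * (PowerSeries.C q * PowerSeries.X) +
      PowerSeries.C p * PowerSeries.X * expQuot (-c) * (PowerSeries.C d * PowerSeries.X);
      0, 0, PowerSeries.C (c + d) * PowerSeries.X; 0, 0, 0] := by
    rw [hK, map_sub, map_mul, map_one, seriesEntries_expSeriesOf_letterMat,
      seriesEntries_expSeriesOf_letterMat, hζ, bchSeries_mul_expQuot, hW, neg_add, expSeries_add]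
    ext1 i j
    fin_cases i <;> fin_cases j <;> simp <;> ring
  have h02 : ∀ k : ℕ, seriesEntries (K ^ (k + 1)) 0 2 =
      W ^ k * ((PowerSeries.X * PowerSeries.derivative ℚ ζ - ζ) * expQuot (-(c + d))) +
        if k = 0 then ζ else 0 := by
    intro k
    rw [expQuot_mul_derivative_bchSeries, map_pow, hentries]
    cases k with
    | zero => simp [hζ]
    | succ k =>
      have h1 := C_mul_X_mul_expQuot (-(c + d))
      rw [map_neg, ← hW] at h1
      rw [mat_pow_add_two]
      simp only [Matrix.of_apply, Matrix.cons_val', Matrix.cons_val_zero, Matrix.cons_val,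
        if_neg (Nat.succ_ne_zero k)]
      linear_combination -W ^ k * ζ * h1
  have h12 : ∀ k : ℕ, seriesEntries (K ^ (k + 1)) 1 2 =
      if k = 0 then PowerSeries.C (c + d) * PowerSeries.X else 0 := by
    intro k
    rw [map_pow, hentries]
    cases k with
    | zero => simp
    | succ k => rw [mat_pow_add_two]; simp
  have hn0 : (n : ℚ) ≠ 0 := Nat.cast_ne_zero.2 hn.ne'
  have hS : ∀ i j, dynkinSum n (letterMat p c) (letterMat q d) i j = (n : ℚ)⁻¹ *
      PowerSeries.coeff n (∑ k ∈ Finset.range n, PowerSeries.C ((-1 : ℚ) ^ k / (k + 1)) *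
        seriesEntries (K ^ (k + 1)) i j) := by
    intro i j
    rw [dynkinSum_eq, Matrix.smul_apply, Matrix.sum_apply, smul_eq_mul, map_sum]
    congr 1
    refine Finset.sum_congr rfl fun k _ => ?_
    rw [Matrix.smul_apply, PowerSeries.coeff_C_mul, coeff_seriesEntries, smul_eq_mul]
  rw [hS, hS, inv_mul_eq_iff_eq_mul₀ hn0, inv_mul_eq_iff_eq_mul₀ hn0]
  have h0 : ∀ f : ℚ⟦X⟧, ∑ k ∈ Finset.range n, PowerSeries.C ((-1 : ℚ) ^ k / (k + 1)) *
      (if k = 0 then f else 0) = f := by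
    intro f
    rw [Finset.sum_eq_single 0]
    · simp
    · intro k _ hk
      rw [if_neg hk, mul_zero]
    · intro h
      exact absurd (Finset.mem_range.2 hn) h
  constructor
  · simp only [h02, mul_add, Finset.sum_add_distrib, h0]
    obtain ⟨h, hh⟩ := exists_sum_log_mul_expQuot (-(c + d)) n
    have e : ∑ k ∈ Finset.range n, PowerSeries.C ((-1 : ℚ) ^ k / (k + 1)) *
        (W ^ k * ((PowerSeries.X * PowerSeries.derivative ℚ ζ - ζ) * expQuot (-(c + d)))) =
        (1 + PowerSeries.X ^ n * h) * (PowerSeries.X * PowerSeries.derivative ℚ ζ - ζ) := by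
      rw [← hh, Finset.sum_mul, Finset.sum_mul]
      refine Finset.sum_congr rfl fun k _ => ?_
      ring
    -- Both Xζ' and ζ are divisible by X, which pushes the truncation error from degree `n` to
    -- degree `n + 1`.
    obtain ⟨ξ, hξ⟩ : PowerSeries.X ∣ ζ := ⟨_, by rw [hζ, bchSeries, mul_assoc]⟩
    have e2 : (1 + PowerSeries.X ^ n * h) * (PowerSeries.X * PowerSeries.derivative ℚ ζ - ζ) + ζ =
        PowerSeries.X * PowerSeries.derivative ℚ ζ +
          PowerSeries.X ^ (n + 1) * (h * (PowerSeries.derivative ℚ ζ - ξ)) := by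
      linear_combination -PowerSeries.X ^ n * h * hξ
    rw [e, e2, map_add, PowerSeries.coeff_X_pow_mul', if_neg (Nat.not_succ_le_self n), add_zero]
    obtain ⟨m, rfl⟩ := Nat.exists_eq_succ_of_ne_zero hn.ne'
    rw [PowerSeries.coeff_succ_X_mul, PowerSeries.coeff_derivative]
    push_cast
    ring
  · simp only [h12, h0]
    rw [PowerSeries.coeff_C_mul, PowerSeries.coeff_X]
    split_ifs with h
    · simp [h]
    · simp

end LetterMatrices

/-! ### The Baker–Campbell–Hausdorff series in the lamplighter Lie algebra. -/

section LamplighterBCH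

open scoped PowerSeries

attribute [local instance] LieRing.ofAssociativeRing

theorem lamplighterLie_lie (x y : LamplighterLie) :
    ⁅x, y⁆ = ⟨X * (C y.right * x.left - C x.right * y.left), 0⟩ := by
  rw [LieAlgebra.SemiDirectSum.lie_eq_mk]
  simp only [LieRing.of_associative_ring_bracket, lamplighterAction]
  ext1
  · simp [smul_eq_C_mul]
    ring
  · simp [mul_comm]

/-- Right-normed brackets are read off from products of the matrices `letterMat`. -/
theorem rightNormed_lamplighterLie {ι : Type*} (p q : ℚ[X]) (u v c : ι → ℚ) (l : List ι)
    (hl : l ≠ []) :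
    rightNormed (l.map fun i => (⟨C (u i) * p + C (v i) * q, c i⟩ : LamplighterLie)) =
      ⟨X ^ (l.length - 1) * (C ((l.map fun i => letterMat (u i) (c i)).prod 0 2) * p +
        C ((l.map fun i => letterMat (v i) (c i)).prod 0 2) * q),
        (l.map fun i => letterMat (u i) (c i)).prod 1 2⟩ ∧
    (l.map fun i => letterMat (v i) (c i)).prod 1 2 =
      (l.map fun i => letterMat (u i) (c i)).prod 1 2 ∧
    (l.map fun i => letterMat (u i) (c i)).prod 2 2 = 0 ∧
    (l.map fun i => letterMat (v i) (c i)).prod 2 2 = 0 ∧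
    X ^ (l.length - 1) * C ((l.map fun i => letterMat (u i) (c i)).prod 1 2) =
      C ((l.map fun i => letterMat (u i) (c i)).prod 1 2) := by
  match l, hl with
  | [i], _ => simp [rightNormed, letterMat]
  | i :: j :: l, _ =>
    obtain ⟨h1, h2, h3, h4, h5⟩ := rightNormed_lamplighterLie p q u v c (j :: l) (by simp)
    simp only [List.map_cons, rightNormed] at h1 h2 h3 h4 h5 ⊢
    rw [h1, lamplighterLie_lie]
    generalize (letterMat (u j) (c j) :: l.map fun i => letterMat (u i) (c i)) = M
      at h1 h2 h3 h4 h5 ⊢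
    generalize (letterMat (v j) (c j) :: l.map fun i => letterMat (v i) (c i)) = N
      at h1 h2 h3 h4 h5 ⊢
    simp only [List.prod_cons, Matrix.mul_apply, Fin.sum_univ_three, letterMat, h2, h3, h4]
    refine ⟨?_, by simp, by simp, by simp, by simp⟩
    ext1
    -- The `t`-part of the tail vanishes unless the tail is a single letter; `h5` states this as an
    -- identity that absorbs the surplus power of `X`.
    · rw [List.length_cons, Nat.add_sub_cancel] at h5
      simp
      linear_combination -X * (C (u i) * p + C (v i) * q) * h5
    · simp

theorem lamplighterLie_sum {ι : Type*} (s : Finset ι) (f : ι → ℚ[X]) (g : ι → ℚ) :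
    ∑ i ∈ s, (⟨f i, g i⟩ : LamplighterLie) = ⟨∑ i ∈ s, f i, ∑ i ∈ s, g i⟩ := by
  classical
  induction s using Finset.induction_on with
  | empty => rfl
  | insert a s ha ih => simp only [Finset.sum_insert ha, ih]; rfl

theorem map_dynkinWord {α β : Type*} (f : α → β) (x y : α) {k : ℕ} (rs : Fin k → ℕ × ℕ) :
    (dynkinWord x y rs).map f = dynkinWord (f x) (f y) rs := by
  simp only [dynkinWord, List.map_flatMap, List.map_append, List.map_replicate]

/-- Right-normed brackets are linear in the pair of abelian parts, so the coefficients of `x.left`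
and `y.left` come from giving the two letters the entries (1, 0) and (0, 1). -/
theorem bchTerm_lamplighterLie_eq_dynkinSum {d : ℕ} (hd : 0 < d) (x y : LamplighterLie) :
    bchTerm d x y =
      ⟨X ^ (d - 1) * (C (dynkinSum d (letterMat 1 x.right) (letterMat 0 y.right) 0 2) * x.left +
        C (dynkinSum d (letterMat 0 x.right) (letterMat 1 y.right) 0 2) * y.left),
        dynkinSum d (letterMat 1 x.right) (letterMat 0 y.right) 1 2⟩ := by
  have key : ∀ k, ∀ rs ∈ dynkinIndex d k, rightNormed (dynkinWord x y rs) =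
      (⟨X ^ (d - 1) *
        (C ((dynkinWord (letterMat 1 x.right) (letterMat 0 y.right) rs).prod 0 2) * x.left +
        C ((dynkinWord (letterMat 0 x.right) (letterMat 1 y.right) rs).prod 0 2) * y.left),
        (dynkinWord (letterMat 1 x.right) (letterMat 0 y.right) rs).prod 1 2⟩ :
        LamplighterLie) := by
    intro k rs hrs
    have hlen : (dynkinWord true false rs).length = d := by
      rw [length_dynkinWord, (mem_dynkinIndex.1 hrs).2]
    have h := (rightNormed_lamplighterLie x.left y.left (fun b => cond b 1 0)
      (fun b => cond b 0 1) (fun b => cond b x.right y.right) (dynkinWord true false rs)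
      (by rw [← List.length_pos_iff, hlen]; exact hd)).1
    rw [map_dynkinWord, map_dynkinWord, map_dynkinWord, hlen] at h
    simpa using h
  rw [bchTerm, dynkinSum, dynkinSum]
  simp only [Matrix.sum_apply, Matrix.smul_apply, map_sum, Finset.sum_mul,
    ← Finset.sum_add_distrib, Finset.mul_sum, ← lamplighterLie_sum]
  refine Finset.sum_congr rfl fun k _ => Finset.sum_congr rfl fun rs hrs => ?_
  rw [key k rs hrs, LieAlgebra.SemiDirectSum.smul_eq_mk]
  ext1
  · simp only [smul_eq_C_mul, smul_eq_mul, map_mul]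
    ring
  · rfl

/-- The coefficient of `p` in the abelian part of the Baker–Campbell–Hausdorff product of `p + c t`
and `q + d t`. -/
noncomputable def bchLeft (c d : ℚ) : ℚ⟦X⟧ := expQuot (-c) * (expQuot (-(c + d)))⁻¹

/-- The coefficient of `q` in the abelian part of the Baker–Campbell–Hausdorff product of `p + c t`
and `q + d t`. -/
noncomputable def bchRight (c d : ℚ) : ℚ⟦X⟧ :=
  expSeries (-c) * expQuot (-d) * (expQuot (-(c + d)))⁻¹

theorem bchTerm_lamplighterLie (d : ℕ) (x y : LamplighterLie) :
    bchTerm (d + 1) x y =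
      ⟨X ^ d * (C (PowerSeries.coeff d (bchLeft x.right y.right)) * x.left +
        C (PowerSeries.coeff d (bchRight x.right y.right)) * y.left),
        if d = 0 then x.right + y.right else 0⟩ := by
  obtain ⟨h1, h2⟩ := dynkinSum_letterMat 1 x.right 0 y.right (n := d + 1) (Nat.succ_pos d)
  obtain ⟨h3, -⟩ := dynkinSum_letterMat 0 x.right 1 y.right (n := d + 1) (Nat.succ_pos d)
  rw [bchTerm_lamplighterLie_eq_dynkinSum (d := d + 1) (Nat.succ_pos d), h1, h2, h3,
    Nat.add_sub_cancel, bchSeries, bchSeries, mul_assoc, mul_assoc, PowerSeries.coeff_succ_X_mul,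
    PowerSeries.coeff_succ_X_mul, bchLeft, bchRight]
  simp

theorem bchPartial_lamplighterLie (n : ℕ) (x y : LamplighterLie) :
    bchPartial (n + 1) x y =
      ⟨(bchLeft x.right y.right).trunc (n + 1) * x.left +
        (bchRight x.right y.right).trunc (n + 1) * y.left, x.right + y.right⟩ := by
  induction n with
  | zero =>
    rw [bchPartial, zero_add, Finset.Icc_self, Finset.sum_singleton]
    rw [show (1 : ℕ) = 0 + 1 from rfl, bchTerm_lamplighterLie]
    simp [PowerSeries.trunc_succ]
  | succ n ih =>
    have h : bchPartial (n + 1 + 1) x y = bchPartial (n + 1) x y + bchTerm (n + 1 + 1) x y :=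
      Finset.sum_Icc_succ_top (Nat.le_add_left 1 (n + 1)) _
    rw [h, ih, bchTerm_lamplighterLie, PowerSeries.trunc_succ _ (n + 1),
      PowerSeries.trunc_succ _ (n + 1), LieAlgebra.SemiDirectSum.add_eq_mk]
    ext1
    · simp only [← C_mul_X_pow_eq_monomial]
      ring
    · simp

end LamplighterBCH

/-! ### The pronilpotent completion as power series. -/

section LamplighterCompletion

open scoped PowerSeries

attribute [local instance] LieRing.ofAssociativeRing

theorem mem_lLCS_succ_iff {n : ℕ} {x : LamplighterLie} :
    x ∈ lLCS LamplighterLie (n + 1) ↔ x.right = 0 ∧ X ^ (n + 1) ∣ x.left := by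
  have lie_eq : ∀ p : ℚ[X], (⟨X * p, 0⟩ : LamplighterLie) =
      ⁅(⟨0, -1⟩ : LamplighterLie), (⟨p, 0⟩ : LamplighterLie)⁆ := fun p => by
    rw [lamplighterLie_lie]
    simp
  have dvd_lie : ∀ (n : ℕ) (x m : LamplighterLie), m.right = 0 → X ^ n ∣ m.left →
      ⁅x, m⁆.right = 0 ∧ X ^ (n + 1) ∣ ⁅x, m⁆.left := fun n x m h0 hm => by
    rw [lamplighterLie_lie]
    refine ⟨rfl, ?_⟩
    rw [pow_succ']
    refine mul_dvd_mul_left _ ?_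
    rw [h0]
    simpa using hm.mul_left _
  let I : ℕ → LieIdeal ℚ LamplighterLie := fun n =>
    { carrier := {x | x.right = 0 ∧ X ^ (n + 1) ∣ x.left}
      zero_mem' := ⟨rfl, dvd_zero _⟩
      add_mem' := fun {x y} hx hy => ⟨by simp [hx.1, hy.1], dvd_add hx.2 hy.2⟩
      smul_mem' := fun r x hx => ⟨by simp [hx.1], by
        simpa [smul_eq_C_mul] using hx.2.mul_left (C r)⟩
      lie_mem := fun {x m} hm =>
        ⟨(dvd_lie _ x m hm.1 hm.2).1,
          (pow_dvd_pow X (Nat.le_succ _)).trans (dvd_lie _ x m hm.1 hm.2).2⟩ }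
  suffices h : lLCS LamplighterLie (n + 1) = I n by
    rw [h]
    rfl
  induction n with
  | zero =>
    refine le_antisymm ((LieSubmodule.lie_le_iff _ _ _).2 fun x _ m _ => ?_) ?_
    · rw [lamplighterLie_lie]
      exact ⟨rfl, by simp⟩
    · rintro ⟨p, c⟩ ⟨h0, q, hq⟩
      obtain rfl : c = 0 := h0
      obtain rfl : p = X * q := by simpa using hq
      rw [lie_eq]
      exact LieSubmodule.lie_mem_lie (LieSubmodule.mem_top _) (LieSubmodule.mem_top _)
  | succ n ih =>
    rw [lLCS, LieModule.lowerCentralSeries_succ]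
    refine le_antisymm ((LieSubmodule.lie_le_iff _ _ _).2 fun x _ m hm => ?_) ?_
    · obtain ⟨h1, h2⟩ := ih.le hm
      exact dvd_lie _ x m h1 h2
    · rintro ⟨p, c⟩ ⟨h0, q, hq⟩
      obtain rfl : c = 0 := h0
      obtain rfl : p = X * (X ^ (n + 1) * q) := by
        rw [← mul_assoc, ← pow_succ']
        exact hq
      rw [lie_eq]
      exact LieSubmodule.lie_mem_lie (LieSubmodule.mem_top _) (ih.ge ⟨rfl, dvd_mul_right _ _⟩)

theorem lamplighterLie_mk_eq_iff {n : ℕ} {x y : LamplighterLie} :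
    (LieSubmodule.Quotient.mk x : LamplighterLie ⧸ lLCS LamplighterLie (n + 1)) =
      LieSubmodule.Quotient.mk y ↔ x.right = y.right ∧ X ^ (n + 1) ∣ x.left - y.left := by
  refine (Submodule.Quotient.eq _).trans (mem_lLCS_succ_iff.trans ?_)
  rw [LieAlgebra.SemiDirectSum.sub_eq_mk, sub_eq_zero]

theorem quotient_lLCS_zero_eq (M : Type*) [LieRing M] [LieAlgebra ℚ M] (x y : M ⧸ lLCS M 0) :
    x = y := by
  obtain ⟨x, rfl⟩ := LieSubmodule.Quotient.surjective_mk' (lLCS M 0) x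
  obtain ⟨y, rfl⟩ := LieSubmodule.Quotient.surjective_mk' (lLCS M 0) y
  exact (Submodule.Quotient.eq _).2 (LieSubmodule.mem_top _)

theorem X_pow_dvd_sub_trunc_iff {n : ℕ} {p : ℚ[X]} {f : ℚ⟦X⟧} :
    X ^ n ∣ p - f.trunc n ↔ PowerSeries.X ^ n ∣ (p : ℚ⟦X⟧) - f := by
  rw [Polynomial.X_pow_dvd_iff, PowerSeries.X_pow_dvd_iff]
  refine forall_congr' fun m => forall_congr' fun hm => ?_
  rw [coeff_sub, map_sub, PowerSeries.coeff_trunc, if_pos hm, Polynomial.coeff_coe]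

/-- The element `f + c t` of the pronilpotent completion. -/
noncomputable def complElt (f : ℚ⟦X⟧) (c : ℚ) : PronilpotentCompletion LamplighterLie :=
  ⟨fun n => LieSubmodule.Quotient.mk ⟨f.trunc n, c⟩, fun m n h => by
    rw [lTransition_mk]
    cases m with
    | zero => exact quotient_lLCS_zero_eq _ _ _
    | succ m =>
      rw [lamplighterLie_mk_eq_iff, X_pow_dvd_sub_trunc_iff, PowerSeries.X_pow_dvd_iff]
      refine ⟨rfl, fun k hk => ?_⟩
      rw [map_sub, Polynomial.coeff_coe, PowerSeries.coeff_trunc, if_pos (hk.trans_le h),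
        sub_self]⟩

theorem mk_eq_complElt_iff {n : ℕ} {p : ℚ[X]} {f : ℚ⟦X⟧} {c d : ℚ} :
    (LieSubmodule.Quotient.mk ⟨p, c⟩ : LamplighterLie ⧸ lLCS LamplighterLie (n + 1)) =
      (complElt f d).1 (n + 1) ↔ c = d ∧ PowerSeries.X ^ (n + 1) ∣ (p : ℚ⟦X⟧) - f :=
  lamplighterLie_mk_eq_iff.trans (and_congr_right fun _ => X_pow_dvd_sub_trunc_iff)

theorem X_pow_dvd_trunc_sub (n : ℕ) (f : ℚ⟦X⟧) :
    PowerSeries.X ^ n ∣ (f.trunc n : ℚ⟦X⟧) - f := by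
  rw [← X_pow_dvd_sub_trunc_iff, sub_self]
  exact dvd_zero _

theorem complElt_apply_eq_iff {n : ℕ} {f g : ℚ⟦X⟧} {c d : ℚ} :
    (complElt f c).1 (n + 1) = (complElt g d).1 (n + 1) ↔
      c = d ∧ PowerSeries.X ^ (n + 1) ∣ f - g := by
  refine (mk_eq_complElt_iff (p := f.trunc (n + 1))).trans (and_congr_right fun _ => ?_)
  rw [← sub_add_sub_cancel _ f g, dvd_add_right (X_pow_dvd_trunc_sub _ _)]

theorem completion_ext {x y : PronilpotentCompletion LamplighterLie}
    (h : ∀ n, x.1 (n + 1) = y.1 (n + 1)) : x = y :=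
  Subtype.ext (funext fun n => n.casesOn (quotient_lLCS_zero_eq _ _ _) h)

theorem complElt_sub (f g : ℚ⟦X⟧) (c d : ℚ) :
    complElt f c - complElt g d = complElt (f - g) (c - d) :=
  Subtype.ext (funext fun n => by
    change LieSubmodule.Quotient.mk _ = LieSubmodule.Quotient.mk _
    rw [map_sub]
    rfl)

theorem complElt_zero : complElt 0 0 = 0 := by
  rw [← sub_self (0 : ℚ⟦X⟧), ← sub_self (0 : ℚ), ← complElt_sub, sub_self]

theorem complElt_lie (f g : ℚ⟦X⟧) (c d : ℚ) : ⁅complElt f c, complElt g d⁆ =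
    complElt (PowerSeries.X * (PowerSeries.C d * f - PowerSeries.C c * g)) 0 := by
  refine completion_ext fun n => ?_
  change LieSubmodule.Quotient.mk
    ⁅(⟨f.trunc (n + 1), c⟩ : LamplighterLie), (⟨g.trunc (n + 1), d⟩ : LamplighterLie)⁆ = _
  rw [lamplighterLie_lie, mk_eq_complElt_iff]
  refine ⟨rfl, ?_⟩
  obtain ⟨u, hu⟩ := X_pow_dvd_trunc_sub (n + 1) f
  obtain ⟨v, hv⟩ := X_pow_dvd_trunc_sub (n + 1) g
  refine ⟨PowerSeries.X * (PowerSeries.C d * u - PowerSeries.C c * v), ?_⟩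
  push_cast
  linear_combination PowerSeries.X * PowerSeries.C d * hu - PowerSeries.X * PowerSeries.C c * hv

theorem complElt_eq_iff {f g : ℚ⟦X⟧} {c d : ℚ} : complElt f c = complElt g d ↔ f = g ∧ c = d := by
  refine ⟨fun h => ?_, fun h => by rw [h.1, h.2]⟩
  have h1 : ∀ n, c = d ∧ PowerSeries.X ^ (n + 1) ∣ f - g := fun n =>
    complElt_apply_eq_iff.1 (by rw [h])
  refine ⟨PowerSeries.ext fun n => ?_, (h1 0).1⟩
  have h2 := PowerSeries.X_pow_dvd_iff.1 (h1 n).2 n (Nat.lt_succ_self n)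
  rwa [map_sub, sub_eq_zero] at h2

theorem exists_eq_complElt (z : PronilpotentCompletion LamplighterLie) :
    ∃ (f : ℚ⟦X⟧) (c : ℚ), z = complElt f c := by
  choose y hy using fun n => LieSubmodule.Quotient.surjective_mk' (lLCS LamplighterLie n) (z.1 n)
  have h2 : ∀ m n, m ≤ n → (LieSubmodule.Quotient.mk (y n) :
      LamplighterLie ⧸ lLCS LamplighterLie m) = LieSubmodule.Quotient.mk (y m) := fun m n h => by
    refine Eq.trans ?_ (hy m).symm
    rw [← z.2 m n h, ← hy n]
    rfl
  refine ⟨PowerSeries.mk fun k => (y (k + 1)).left.coeff k, (y 1).right, completion_ext fun n => ?_⟩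
  rw [← hy (n + 1)]
  refine mk_eq_complElt_iff.2 ⟨(lamplighterLie_mk_eq_iff.1 (h2 1 (n + 1) (Nat.le_add_left _ _))).1,
    PowerSeries.X_pow_dvd_iff.2 fun k hk => ?_⟩
  have h3 := Polynomial.X_pow_dvd_iff.1 (lamplighterLie_mk_eq_iff.1 (h2 (k + 1) (n + 1) hk)).2 k
    (Nat.lt_succ_self k)
  rw [map_sub, Polynomial.coeff_coe, PowerSeries.coeff_mk, ← coeff_sub, h3]

/-- The projections of the pronilpotent completion to the nilpotent quotients. -/
def complProj (L : Type*) [LieRing L] [LieAlgebra ℚ L] (n : ℕ) :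
    PronilpotentCompletion L →ₗ⁅ℚ⁆ (L ⧸ lLCS L n) where
  toFun z := z.1 n
  map_add' _ _ := rfl
  map_smul' _ _ := rfl
  map_lie' := rfl

theorem complElt_apply_eq_zero_iff {n : ℕ} {f : ℚ⟦X⟧} {c : ℚ} :
    (complElt f c).1 (n + 1) = 0 ↔ c = 0 ∧ PowerSeries.X ^ (n + 1) ∣ f := by
  have h := complElt_apply_eq_iff (n := n) (f := f) (g := 0) (c := c) (d := 0)
  rwa [complElt_zero, sub_zero] at h

/-- The lower central series of the completion is formed without closure, so this is not formal. It
holds because any series divisible by `X` is a single bracket with `-t`. -/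
theorem lLCS_completion_eq_ker (n : ℕ) :
    lLCS (PronilpotentCompletion LamplighterLie) n = (complProj LamplighterLie n).ker := by
  have lie_eq : ∀ f : ℚ⟦X⟧, complElt (PowerSeries.X * f) 0 =
      ⁅complElt 0 (-1), complElt f 0⁆ := fun f => by
    rw [complElt_lie]
    simp
  induction n with
  | zero =>
    refine le_antisymm (fun z _ => ?_) le_top
    exact LieHom.mem_ker.2 (quotient_lLCS_zero_eq _ _ _)
  | succ n ih =>
    rw [lLCS, LieModule.lowerCentralSeries_succ]
    refine le_antisymm ((LieSubmodule.lie_le_iff _ _ _).2 fun x _ m hm => ?_) fun z hz => ?_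
    · have hm' : m.1 n = 0 := LieHom.mem_ker.1 (ih.le hm)
      obtain ⟨f, c, rfl⟩ := exists_eq_complElt x
      obtain ⟨g, d, rfl⟩ := exists_eq_complElt m
      rw [complElt_lie, LieHom.mem_ker]
      refine complElt_apply_eq_zero_iff.2 ⟨rfl, ?_⟩
      rw [pow_succ']
      refine mul_dvd_mul_left _ ?_
      -- At index 0 nothing is known about the `t`-part `d`, but then only divisibility by `X` is
      -- claimed.
      cases n with
      | zero => simp
      | succ n =>
        obtain ⟨rfl, hg⟩ := complElt_apply_eq_zero_iff.1 hm'
        simpa using hg.mul_left _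
    · have hz' : z.1 (n + 1) = 0 := LieHom.mem_ker.1 hz
      obtain ⟨f, c, rfl⟩ := exists_eq_complElt z
      obtain ⟨rfl, g, rfl⟩ := complElt_apply_eq_zero_iff.1 hz'
      rw [pow_succ', mul_assoc, lie_eq]
      refine LieSubmodule.lie_mem_lie (LieSubmodule.mem_top _) (ih.ge ?_)
      rw [LieHom.mem_ker]
      cases n with
      | zero => exact quotient_lLCS_zero_eq _ _ _
      | succ n => exact complElt_apply_eq_zero_iff.2 ⟨rfl, dvd_mul_right _ _⟩

theorem mem_lLCS_completion_iff {n : ℕ} {z : PronilpotentCompletion LamplighterLie} :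
    z ∈ lLCS (PronilpotentCompletion LamplighterLie) n ↔ z.1 n = 0 := by
  rw [lLCS_completion_eq_ker]
  exact LieHom.mem_ker

theorem isPronilpotent_completion : IsPronilpotent (PronilpotentCompletion LamplighterLie) := by
  constructor
  · intro x y h
    refine Subtype.ext (funext fun n => sub_eq_zero.1 ?_)
    exact mem_lLCS_completion_iff.1
      ((Submodule.Quotient.eq _).1 (congrFun (congrArg Subtype.val h) n))
  · intro F
    choose y hy using fun n => LieSubmodule.Quotient.surjective_mk'
      (lLCS (PronilpotentCompletion LamplighterLie) n) (F.1 n)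
    have h1 : ∀ m n, m ≤ n → (y n).1 m = (y m).1 m := fun m n h => by
      refine sub_eq_zero.1 ((mem_lLCS_completion_iff (z := y n - y m)).1
        ((Submodule.Quotient.eq _).1 ?_))
      refine Eq.trans ?_ (hy m).symm
      rw [← F.2 m n h, ← hy n]
      rfl
    refine ⟨⟨fun n => (y n).1 n, fun m n h => ?_⟩, Subtype.ext (funext fun n => ?_)⟩
    · rw [(y n).2 m n h, h1 m n h]
    · rw [← hy n]
      exact (Submodule.Quotient.eq _).2 (mem_lLCS_completion_iff.2 (sub_self _))

theorem isBCHProduct_bch (x y : PronilpotentCompletion LamplighterLie) :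
    IsBCHProduct x y (bch x y) := fun n => by
  rw [mem_lLCS_completion_iff]
  change complProj LamplighterLie n (bch x y - bchPartial n x y) = 0
  rw [map_sub, bchPartial_map]
  exact sub_self _

theorem bch_complElt (f g : ℚ⟦X⟧) (c d : ℚ) : bch (complElt f c) (complElt g d) =
    complElt (bchLeft c d * f + bchRight c d * g) (c + d) := by
  refine completion_ext fun n => ?_
  let π : LamplighterLie →ₗ⁅ℚ⁆ (LamplighterLie ⧸ lLCS LamplighterLie (n + 1)) :=
    { (lLCS LamplighterLie (n + 1)).toSubmodule.mkQ with map_lie' := rfl }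
  refine (bchPartial_map π (n + 1) ⟨f.trunc (n + 1), c⟩ ⟨g.trunc (n + 1), d⟩).symm.trans ?_
  rw [bchPartial_lamplighterLie]
  refine mk_eq_complElt_iff.2 ⟨rfl, ?_⟩
  obtain ⟨u, hu⟩ := X_pow_dvd_trunc_sub (n + 1) f
  obtain ⟨v, hv⟩ := X_pow_dvd_trunc_sub (n + 1) g
  obtain ⟨r, hr⟩ := X_pow_dvd_trunc_sub (n + 1) (bchLeft c d)
  obtain ⟨s, hs⟩ := X_pow_dvd_trunc_sub (n + 1) (bchRight c d)
  refine ⟨(PowerSeries.trunc (n + 1) (bchLeft c d) : ℚ⟦X⟧) * u + f * r +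
    (PowerSeries.trunc (n + 1) (bchRight c d) : ℚ⟦X⟧) * v + g * s, ?_⟩
  push_cast
  linear_combination (PowerSeries.trunc (n + 1) (bchLeft c d) : ℚ⟦X⟧) * hu + f * hr +
    (PowerSeries.trunc (n + 1) (bchRight c d) : ℚ⟦X⟧) * hv + g * hs

end LamplighterCompletion

/-! ### The logarithm isomorphism. -/

section MainTheorem

open scoped PowerSeries

/-- The logarithm from the group `ExpAffine` to the pronilpotent completion. -/
noncomputable def logEquiv : ExpAffine ≃ PronilpotentCompletion LamplighterLie :=
  -- The exponential of !![-cX, p; 0, 0] has corner entry p · `expQuot (-c)`, so the logarithm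
  -- divides by this unit.
  Equiv.ofBijective (fun x => complElt (x.ser * (expQuot (-x.scal))⁻¹) x.scal) <| by
    have h0 : ∀ c, (expQuot (-c))⁻¹ * expQuot (-c) = 1 := fun c =>
      PowerSeries.inv_mul_cancel _ (by rw [constantCoeff_expQuot]; exact one_ne_zero)
    constructor
    · rintro ⟨f, c⟩ ⟨g, d⟩ h
      obtain ⟨h1, h2⟩ := complElt_eq_iff.1 h
      dsimp only at h1 h2
      subst h2
      congr 1
      linear_combination expQuot (-c) * h1 - (f - g) * h0 c
    · intro z
      obtain ⟨f, c, rfl⟩ := exists_eq_complElt z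
      refine ⟨⟨f * expQuot (-c), c⟩, complElt_eq_iff.2 ⟨?_, rfl⟩⟩
      linear_combination f * h0 c

/-- With x = (f, c) and y = (g, d), the units `expQuot (-c)` and `expQuot (-d)` in `bchLeft` and
`bchRight` cancel those of the logarithms; both sides have abelian part (f + e^{-cX} g) / `expQuot
(-(c + d))`. -/
theorem logEquiv_mul (x y : ExpAffine) : logEquiv (x * y) = bch (logEquiv x) (logEquiv y) := by
  have h0 : ∀ c, (expQuot (-c))⁻¹ * expQuot (-c) = 1 := fun c =>
    PowerSeries.inv_mul_cancel _ (by rw [constantCoeff_expQuot]; exact one_ne_zero)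
  refine Eq.trans (b := complElt _ _) ?_ (bch_complElt (x.ser * (expQuot (-x.scal))⁻¹)
    (y.ser * (expQuot (-y.scal))⁻¹) x.scal y.scal).symm
  refine complElt_eq_iff.2 ⟨?_, rfl⟩
  rw [bchLeft, bchRight, ExpAffine.mul_ser, ExpAffine.mul_scal]
  linear_combination (-x.ser * (expQuot (-(x.scal + y.scal)))⁻¹) * h0 x.scal -
    expSeries (-x.scal) * y.ser * (expQuot (-(x.scal + y.scal)))⁻¹ * h0 y.scal

theorem logEquiv_sub_mem_iff (n : ℕ) (x y : ExpAffine) : x⁻¹ * y ∈ gLCS ExpAffine n ↔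
    logEquiv x - logEquiv y ∈ lLCS (PronilpotentCompletion LamplighterLie) n := by
  cases n with
  | zero => exact iff_of_true (Subgroup.mem_top _) (LieSubmodule.mem_top _)
  | succ n =>
    rw [ExpAffine.inv_mul_mem_gLCS_succ_iff, mem_lLCS_completion_iff]
    have e : logEquiv x - logEquiv y = complElt (x.ser * (expQuot (-x.scal))⁻¹ -
      y.ser * (expQuot (-y.scal))⁻¹) (x.scal - y.scal) := complElt_sub _ _ _ _
    rw [e, complElt_apply_eq_zero_iff, sub_eq_zero]
    refine and_congr_right fun h => ?_
    have hu : IsUnit (expQuot (-y.scal))⁻¹ := .of_mul_eq_one _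
      (PowerSeries.inv_mul_cancel _ (by rw [constantCoeff_expQuot]; exact one_ne_zero))
    rw [h, ← sub_mul, hu.dvd_mul_right]

theorem mulEquiv_mem_gLCS_iff {G H : Type*} [Group G] [Group H] (θ : G ≃* H) {n : ℕ} {g : G} :
    θ g ∈ gLCS H n ↔ g ∈ gLCS G n := by
  refine ⟨fun h => ?_, fun h => map_gLCS_le θ.toMonoidHom n (Subgroup.mem_map_of_mem _ h)⟩
  simpa using map_gLCS_le θ.symm.toMonoidHom n (Subgroup.mem_map_of_mem _ h)

end MainTheorem

end Lamplighter

theorem theorem1 :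
    (∃ (Γ : Type) (_ : Group Γ) (η : Lamplighter.LamplighterGroup →* Γ),
      Lamplighter.IsMalcevCompletion η) ∧
    ∀ (Γ : Type*) [Group Γ] (η : Lamplighter.LamplighterGroup →* Γ),
      Lamplighter.IsMalcevCompletion η →
        Lamplighter.IsAssociatedLieAlgebra Γ
          (Lamplighter.PronilpotentCompletion Lamplighter.LamplighterLie) ∧
        ∃ e : Γ ≃ Lamplighter.PronilpotentCompletion Lamplighter.LamplighterLie,
          ∀ g h : Γ, e (g * h) = Lamplighter.bch (e g) (e h) := by
  refine ⟨⟨Lamplighter.ExpAffine, inferInstance, Lamplighter.LamplighterGroup.toExpAffine,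
    Lamplighter.LamplighterGroup.isMalcevCompletion_toExpAffine⟩, fun Γ _ η hη => ?_⟩
  obtain ⟨θ⟩ := hη.nonempty_mulEquiv
    Lamplighter.LamplighterGroup.isMalcevCompletion_toExpAffine
  have hmul : ∀ g h : Γ, Lamplighter.logEquiv (θ (g * h)) =
      Lamplighter.bch (Lamplighter.logEquiv (θ g)) (Lamplighter.logEquiv (θ h)) := fun g h => by
    rw [map_mul, Lamplighter.logEquiv_mul]
  refine ⟨⟨hη.1, Lamplighter.isPronilpotent_completion, θ.toEquiv.trans Lamplighter.logEquiv,
    fun g h => ?_, fun n g h => ?_⟩, θ.toEquiv.trans Lamplighter.logEquiv, hmul⟩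
  · have := Lamplighter.isBCHProduct_bch (Lamplighter.logEquiv (θ g)) (Lamplighter.logEquiv (θ h))
    rw [← hmul] at this
    exact this
  · rw [← Lamplighter.mulEquiv_mem_gLCS_iff θ, map_mul, map_inv]
    exact Lamplighter.logEquiv_sub_mem_iff n (θ g) (θ h)
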